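/- Let $(\mathcal Z,P)$ be a probability space, $\Theta$ a set of parameters, $\theta_{\mathrm{ref}}$ a reference parameter (not necessarily in $\Theta$), and $\ell(\theta,z)$ a loss, jointly measurable in $(\theta,z)$, with $\ell(\theta,\cdot)\in[M_0,M_1]$ for all $\theta\in\Theta\cup\{\theta_{\mathrm{ref}}\}$; put $M=M_1-M_0$ and $R(\theta)=\mathbb E_{z\sim P}[\ell(\theta,z)]$. Let $d_v<\infty$ be the VC-dimension of $\{\ell(\theta,\cdot)-\ell(\theta_{\mathrm{ref}},\cdot):\theta\in\Theta\}$, i.e. the largest cardinality of a finite set of points of $\mathcal Z\times\mathbb R$ shattered by the subgraphs $\{(z,s): s<\ell(\theta,z)-\ell(\theta_{\mathrm{ref}},z)\}$, $\theta\in\Theta$. For $n\ge 1$ and i.i.d. samples $z_1,\dots,z_n\sim P$, define the DRRho risk with the $\chi^2$-divergence, $\phi(t)=(t-1)^2/2$, by $$F(\theta)=\sup\Big\{\sum_{i=1}^n p_i\big(\ell(\theta,z_i)-\ell(\theta_{\mathrm{ref}},z_i)\big)\;:\;p_i\ge 0,\ \sum_{i=1}^n p_i=1,\ \frac1n\sum_{i=1}^n\phi(np_i)\le\frac{\rho}{n}\Big\},$$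 and let $\tilde\theta_*$, a measurable function of the sample, satisfy $\tilde\theta_*\in\arg\min_{\theta\in\Theta}F(\theta)$ almost surely. There is a numerical constant $c\in(0,\infty)$, independent of all the data above and of $n,\delta,\rho$, such that the following holds. Let $\delta>0$ and $$C_1=\log\tfrac1\delta+\log c+d_v\log(16e)+2d_v\log n .$$ If $C_1 n\ge 32M^2$ and $\rho\ge 9C_1$, then with probability at least $1-\delta$, $$R(\tilde\theta_*)\le\inf_{\theta\in\Theta}\Big(R(\theta)+2\sqrt{\tfrac{2\rho}{n}\operatorname{Var}_{z\sim P}\big(\ell(\theta,z)-\ell(\theta_{\mathrm{ref}},z)\big)}\Big)+\frac{(50\rho/3+4)M}{n}.$$ -/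

import Mathlib

open MeasureTheory ProbabilityTheory

universe u v

noncomputable section

namespace DRRho

/-- A family `C` of subsets of `α` shatters the finite set `s` if it picks out every subset of `s`. -/
def Shatters {α : Type*} (C : Set (Set α)) (s : Finset α) : Prop :=
  ∀ t : Set α, t ⊆ (s : Set α) → ∃ A ∈ C, (s : Set α) ∩ A = t

/-- VC-dimension of a family of sets: the supremum of the sizes of the shattered finite sets. -/
def setVCDim {α : Type*} (C : Set (Set α)) : ℕ∞ :=
  ⨆ (s : Finset α) (_ : Shatters C s), (s.card : ℕ∞)

/-- Subgraph of a real-valued function. -/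
def subgraph {Z : Type*} (f : Z → ℝ) : Set (Z × ℝ) := {q | q.2 < f q.1}

/-- VC-dimension of a class of real-valued functions: that of the family of their subgraphs. -/
def vcDim {Z : Type*} (F : Set (Z → ℝ)) : ℕ∞ := setVCDim (subgraph '' F)

/-- The function `φ(t) = (t - 1)² / 2` that defines the `χ²`-divergence. -/
def chiSqPhi (t : ℝ) : ℝ := (t - 1) ^ 2 / 2

/-- `D_φ(p, 1/n) = (1/n) ∑ᵢ φ(n pᵢ)`: the `φ`-divergence of `p` from the uniform weights. -/
def phiDiv (φ : ℝ → ℝ) {n : ℕ} (p : Fin n → ℝ) : ℝ :=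
  (1 / (n : ℝ)) * ∑ i, φ (p i * n)

/-- The probability vectors `p` with `D_φ(p, 1/n) ≤ ρ / n`. -/
def uncertaintySet (φ : ℝ → ℝ) (n : ℕ) (ρ : ℝ) : Set (Fin n → ℝ) :=
  {p | p ∈ stdSimplex ℝ (Fin n) ∧ phiDiv φ p ≤ ρ / n}

/-- The shifted (RHO) loss `ℓ(θ, ·) - ℓ(θ_ref, ·)`. -/
def rhoLoss {W : Type*} {Z : Type*} (ℓ : W → Z → ℝ) (θref θ : W) : Z → ℝ :=
  fun z => ℓ θ z - ℓ θref z

/-- The DRRho risk of `θ` on the sample `S = (z₁, …, zₙ)`. -/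
def drrhoRisk {W : Type*} {Z : Type*} (φ : ℝ → ℝ) (ℓ : W → Z → ℝ) (θref : W) (ρ : ℝ)
    {n : ℕ} (S : Fin n → Z) (θ : W) : ℝ :=
  sSup ((fun p : Fin n → ℝ => ∑ i, p i * rhoLoss ℓ θref θ (S i)) '' uncertaintySet φ n ρ)

/-- The expected risk `R(θ) = E_{z ∼ P} ℓ(θ, z)`. -/
def risk {W : Type*} {Z : Type*} [MeasurableSpace Z] (ℓ : W → Z → ℝ) (P : Measure Z)
    (θ : W) : ℝ :=
  ∫ z, ℓ θ z ∂P

/-- `C₁ = log (1/δ) + log c + d log (16 e) + 2 d log n`. -/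
def constC1 (c δ : ℝ) (d n : ℕ) : ℝ :=
  Real.log (1 / δ) + Real.log c + d * Real.log (16 * Real.exp 1) + 2 * d * Real.log n

end DRRho

end

/-!
The proof sandwiches the DRRho risk. Write `f` for a shifted loss, `M = M₁ - M₀` for the bound on its
absolute value, and `V̂` for its empirical variance on the sample. By the Cauchy–Schwarz inequality
the worst reweighting in the `χ²` ball raises the empirical mean by at most `√(2 ρ V̂ / n)`
(`drrhoRisk_le`), and it does raise it by that much up to `4 M ρ / n` (`mean_add_le_drrhoRisk`). As
`θtilde` minimizes the DRRho risk, it suffices to compare expectation and empirical mean plus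
deviation term in two ways:

* at the minimizer, `𝔼 f ≤ 𝔼̂ f + √(2 ρ V̂ / n) + O(M ρ / n)`, which has to hold uniformly over
  the class (`pi_real_expected_gt_le`);
* at one fixed near-minimizer of the right-hand side, the reverse comparison
  `𝔼̂ f + √(2 ρ V̂ / n) ≤ 𝔼 f + 2 √(2 ρ Var f / n) + O(M ρ / n)`, which is Bernstein's inequality
  for `f` and for `(f - 𝔼 f) ^ 2` (`pi_real_empirical_gt_le`).

The uniform comparison is an empirical Bernstein inequality, proved by symmetrization. With
probability at least `1 / 2` an independent second sample sees `𝔼 f` up to a term in its own spread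
(`half_le_pi_real`), so a failure at the minimizer produces a discrepancy between the two samples.
Their joint law does not change when entries are exchanged between them
(`prod_pi_real_le_of_exchange`), so it is enough to count, for two fixed samples, the exchanges that
produce a discrepancy for some `θ` (`card_exchanges_le`). On the `2 n` points the functions are
rounded to multiples of `M / n`; by the Sauer–Shelah lemma there are at most `(4 n² + 1) ^ d` rounded
functions (`exists_rounding`). For each of them Hoeffding's inequality for random signs
(`card_signs_le`) is applied to the differences between the samples and to those of the squared
deviations from the joint mean. The second application bounds the joint spread of both samples by
that of the first (`exists_joint_spread`), which makes the bound depend on `V̂` alone. Since the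
symmetrization takes place at the measurable parameter `θtilde`, suprema over `Θ` are only taken
inside finite counts, and their measurability is never needed.

Each bound for a single function fails with probability at most a multiple of `exp (-C₁)`, and `C₁`
is such that the sum over the rounded class stays below `δ` (`union_bound_le`), with `c = exp 100`. This large `c`
forces `C₁ ≥ 100` when `δ ≤ 1`, the only case of interest; moreover, unless `n > 50 ρ / 3 + 4`, the claim holds because risks differ by at
most `M`. So `n` may be taken large compared with `C₁`, which absorbs all lower order terms.
-/

namespace DRRho

/-! ### Empirical means, spreads, and the `χ²` risk -/

/-- The mean of a finite real sample. -/
noncomputable def mean {n : ℕ} (x : Fin n → ℝ) : ℝ := (∑ i, x i) / n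

/-- The sum of squared deviations of a finite real sample from its mean, that is, `n` times the
(biased) empirical variance. -/
noncomputable def ssd {n : ℕ} (x : Fin n → ℝ) : ℝ := ∑ i, (x i - mean x) ^ 2

lemma ssd_nonneg {n : ℕ} (x : Fin n → ℝ) : 0 ≤ ssd x :=
  Finset.sum_nonneg fun _ _ => sq_nonneg _

lemma sum_eq_mul_mean {n : ℕ} (hn : 0 < n) (x : Fin n → ℝ) : ∑ i, x i = n * mean x := by
  have : (n : ℝ) ≠ 0 := by positivity
  rw [mean]; field_simp

lemma sum_sub_sq_eq {n : ℕ} (hn : 0 < n) (x : Fin n → ℝ) (a : ℝ) :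
    ∑ i, (x i - a) ^ 2 = ssd x + n * (mean x - a) ^ 2 := by
  have h1 : ∀ i, (x i - a) ^ 2 =
      (x i - mean x) ^ 2 + 2 * (mean x - a) * x i + (a ^ 2 - (mean x) ^ 2) := by
    intro i; ring
  simp only [h1, Finset.sum_add_distrib, ← Finset.mul_sum, sum_eq_mul_mean hn x, ssd]
  simp
  ring

lemma ssd_le_sum_sub_sq {n : ℕ} (hn : 0 < n) (x : Fin n → ℝ) (a : ℝ) :
    ssd x ≤ ∑ i, (x i - a) ^ 2 := by
  rw [sum_sub_sq_eq hn]
  have : (0 : ℝ) ≤ n * (mean x - a) ^ 2 := by positivity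
  linarith

lemma abs_mean_le {n : ℕ} (hn : 0 < n) {x : Fin n → ℝ} {M : ℝ} (hx : ∀ i, |x i| ≤ M) :
    |mean x| ≤ M := by
  have hn' : (0 : ℝ) < n := by exact_mod_cast hn
  rw [mean, abs_div, abs_of_pos hn', div_le_iff₀ hn']
  calc |∑ i, x i| ≤ ∑ i, |x i| := Finset.abs_sum_le_sum_abs _ _
    _ ≤ ∑ _i : Fin n, M := Finset.sum_le_sum fun i _ => hx i
    _ = M * n := by simp [mul_comm]

/-- By the Cauchy–Schwarz inequality, reweighting within the `χ²` ball raises a mean by at most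
`√(2ρ ssd x) / n`. -/
lemma sum_mul_le_of_mem_uncertaintySet {n : ℕ} (hn : 0 < n) {ρ : ℝ} {p : Fin n → ℝ}
    (hp : p ∈ uncertaintySet chiSqPhi n ρ) (x : Fin n → ℝ) :
    ∑ i, p i * x i ≤ mean x + √(2 * ρ * ssd x) / n := by
  have hn' : (0 : ℝ) < n := by exact_mod_cast hn
  obtain ⟨⟨-, hp1⟩, hp2⟩ := hp
  have h1 : ∑ i, (p i * n - 1) ^ 2 ≤ 2 * ρ := by
    simp only [phiDiv, chiSqPhi, ← Finset.sum_div] at hp2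
    rw [one_div, inv_mul_le_iff₀ hn', mul_div_cancel₀ _ hn'.ne'] at hp2
    linarith
  have h2 : ∑ i, (p i * n - 1) * (x i - mean x) = n * (∑ i, p i * x i - mean x) := by
    have : ∀ i, (p i * n - 1) * (x i - mean x) =
        n * (p i * x i) - x i - (n * mean x) * p i + mean x := by intro i; ring
    simp only [this, Finset.sum_add_distrib, Finset.sum_sub_distrib, ← Finset.mul_sum, hp1,
      sum_eq_mul_mean hn x]
    simp
    ring
  have h3 := Finset.sum_mul_sq_le_sq_mul_sq Finset.univ (fun i => p i * n - 1)
    (fun i => x i - mean x)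
  have h4 : (n * (∑ i, p i * x i - mean x)) ^ 2 ≤ 2 * ρ * ssd x := by
    rw [← h2]
    exact h3.trans (mul_le_mul_of_nonneg_right h1 (ssd_nonneg x))
  have h5 := Real.le_sqrt_of_sq_le h4
  rw [← sub_le_iff_le_add', le_div_iff₀ hn']
  linarith

lemma const_mem_uncertaintySet {n : ℕ} (hn : 0 < n) {ρ : ℝ} (hρ : 0 ≤ ρ) :
    (fun _ => 1 / (n : ℝ)) ∈ uncertaintySet chiSqPhi n ρ := by
  have hn' : (0 : ℝ) < n := by exact_mod_cast hn
  refine ⟨⟨fun _ => by positivity, by simp [hn'.ne']⟩, ?_⟩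
  simp [phiDiv, chiSqPhi, hn'.ne']
  positivity

section risk
variable {W Z : Type*} {ℓ : W → Z → ℝ} {θref θ : W} {n : ℕ} {S : Fin n → Z} {ρ : ℝ}

lemma drrhoRisk_le (hn : 0 < n) (hρ : 0 ≤ ρ) :
    drrhoRisk chiSqPhi ℓ θref ρ S θ ≤ mean (fun i => rhoLoss ℓ θref θ (S i)) +
      √(2 * ρ * ssd fun i => rhoLoss ℓ θref θ (S i)) / n := by
  refine csSup_le ⟨_, _, const_mem_uncertaintySet hn hρ, rfl⟩ ?_
  rintro _ ⟨p, hp, rfl⟩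
  exact sum_mul_le_of_mem_uncertaintySet hn hp _

/-- Unless the empirical variance is so small that the term `4 M ρ / n` takes care of it, the
Cauchy–Schwarz bound is attained by the weights `(1 + √(2ρ / ssd x) (xᵢ - mean x)) / n`, which are
then nonnegative. -/
lemma mean_add_le_drrhoRisk (hn : 0 < n) (hρ : 0 ≤ ρ) {M : ℝ} (hM : 0 ≤ M)
    (hx : ∀ i, |rhoLoss ℓ θref θ (S i)| ≤ M) :
    mean (fun i => rhoLoss ℓ θref θ (S i)) +
      √(2 * ρ * ssd fun i => rhoLoss ℓ θref θ (S i)) / n ≤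
      drrhoRisk chiSqPhi ℓ θref ρ S θ + 4 * M * ρ / n := by
  set x : Fin n → ℝ := fun i => rhoLoss ℓ θref θ (S i) with hxdef
  have hn' : (0 : ℝ) < n := by exact_mod_cast hn
  have hle : ∀ p ∈ uncertaintySet chiSqPhi n ρ,
      ∑ i, p i * x i ≤ drrhoRisk chiSqPhi ℓ θref ρ S θ := by
    intro p hp
    refine le_csSup ⟨mean x + √(2 * ρ * ssd x) / n, ?_⟩ ⟨p, hp, rfl⟩
    rintro _ ⟨q, hq, rfl⟩
    exact sum_mul_le_of_mem_uncertaintySet hn hq _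
  rcases le_or_gt (ssd x) (8 * ρ * M ^ 2) with h | h
  · have h1 : √(2 * ρ * ssd x) ≤ 4 * M * ρ := by
      apply Real.sqrt_le_iff.2 ⟨by positivity, ?_⟩
      nlinarith
    have h2 := hle _ (const_mem_uncertaintySet hn hρ)
    have h3 : ∑ i, 1 / (n : ℝ) * x i = mean x := by
      rw [← Finset.mul_sum, mean]; ring
    rw [h3] at h2
    gcongr
  · have hs : 0 < ssd x := lt_of_le_of_lt (by positivity) h
    set lam := √(2 * ρ / ssd x) with hlam
    have hlam2 : lam ^ 2 = 2 * ρ / ssd x := Real.sq_sqrt (by positivity)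
    have hdev : ∀ i, |lam * (x i - mean x)| ≤ 1 := by
      intro i
      have h1 : |x i - mean x| ≤ 2 * M := by
        have := abs_sub (x i) (mean x)
        have := abs_mean_le hn hx
        have := hx i
        linarith
      rw [abs_le_one_iff_mul_self_le_one]
      have h2 : (x i - mean x) ^ 2 ≤ (2 * M) ^ 2 :=
        sq_le_sq' (by linarith [abs_le.1 h1]) (abs_le.1 h1).2
      calc lam * (x i - mean x) * (lam * (x i - mean x)) = lam ^ 2 * (x i - mean x) ^ 2 := by ring
        _ ≤ 2 * ρ / ssd x * (2 * M) ^ 2 := by rw [hlam2]; gcongr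
        _ ≤ 1 := by
          rw [div_mul_eq_mul_div, div_le_one hs]; linarith
    have hsum0 : ∑ i, (x i - mean x) = 0 := by
      simp [Finset.sum_sub_distrib, sum_eq_mul_mean hn x]
    set p : Fin n → ℝ := fun i => (1 + lam * (x i - mean x)) / n with hp
    have hpm : p ∈ uncertaintySet chiSqPhi n ρ := by
      refine ⟨⟨fun i => ?_, ?_⟩, ?_⟩
      · have := (abs_le.1 (hdev i)).1
        simp only [hp]
        exact div_nonneg (by linarith) hn'.le
      · simp only [hp, ← Finset.sum_div, Finset.sum_add_distrib, ← Finset.mul_sum, hsum0]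
        simp [hn'.ne']
      · have h1 : ∀ i, chiSqPhi (p i * n) = lam ^ 2 / 2 * (x i - mean x) ^ 2 := by
          intro i
          simp only [hp, chiSqPhi, div_mul_cancel₀ _ hn'.ne']
          ring
        have h2 : ∑ i, (x i - mean x) ^ 2 = ssd x := rfl
        simp only [phiDiv, h1, ← Finset.mul_sum, h2]
        rw [hlam2]
        apply le_of_eq
        field_simp
    have h2 := hle p hpm
    have h3 : ∑ i, p i * x i = mean x + √(2 * ρ * ssd x) / n := by
      have e1 : ∀ i, p i * x i =
          (x i + lam * (x i - mean x) ^ 2 + lam * mean x * (x i - mean x)) / n := by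
        intro i; simp only [hp]; ring
      have e2 : √(2 * ρ * ssd x) = lam * ssd x := by
        rw [hlam, show 2 * ρ * ssd x = 2 * ρ / ssd x * (ssd x) ^ 2 by field_simp,
          Real.sqrt_mul (by positivity), Real.sqrt_sq hs.le]
      simp only [e1, ← Finset.sum_div, Finset.sum_add_distrib, ← Finset.mul_sum, hsum0,
        e2, sum_eq_mul_mean hn x]
      rw [← ssd]
      field_simp
      ring
    have : 0 ≤ 4 * M * ρ / n := by positivity
    linarith

end risk

/-! ### Sums with random signs -/

/-- Hoeffding's inequality for a uniformly random choice of signs, as a count of sign patterns. -/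
lemma card_signs_le {n : ℕ} (a : Fin n → ℝ) {t : ℝ} (ht : 0 ≤ t) :
    (((Finset.univ : Finset (Fin n → Bool)).filter fun σ =>
      2 * t * ∑ i, a i ^ 2 < (∑ i, (if σ i then - a i else a i)) ^ 2).card : ℝ) ≤
      2 * Real.exp (-t) * 2 ^ n := by
  classical
  set A := ∑ i, a i ^ 2 with hA
  have hA0 : 0 ≤ A := Finset.sum_nonneg fun _ _ => sq_nonneg _
  rcases hA0.eq_or_lt with h0 | hpos
  · have ha : ∀ i, a i = 0 := by
      intro i
      have := (Finset.sum_eq_zero_iff_of_nonneg (fun i _ => sq_nonneg (a i))).1 h0.symm i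
        (Finset.mem_univ _)
      simpa using this
    simp [ha, ← h0]
    positivity
  -- the optimal exponent
  set lam := √(2 * t / A) with hlam
  have hlam2 : lam ^ 2 = 2 * t / A := Real.sq_sqrt (by positivity)
  have key : ∀ σ : Fin n → Bool, 2 * t * A < (∑ i, (if σ i then - a i else a i)) ^ 2 →
      Real.exp (2 * t) ≤ ∏ i, Real.exp (lam * (if σ i then - a i else a i)) +
        ∏ i, Real.exp (-lam * (if σ i then - a i else a i)) := by
    intro σ hσ
    set X := ∑ i, (if σ i then - a i else a i)
    have h1 : 2 * t ≤ |lam * X| := by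
      refine (sq_le_sq₀ (by positivity) (abs_nonneg _)).1 ?_
      rw [sq_abs, mul_pow lam X, hlam2, div_mul_eq_mul_div, le_div_iff₀ hpos]
      nlinarith
    rw [← Real.exp_sum, ← Real.exp_sum, ← Finset.mul_sum, ← Finset.mul_sum]
    rcases le_abs.1 h1 with h | h
    · have := Real.exp_le_exp.2 h
      have := Real.exp_pos (-lam * X)
      linarith
    · have := Real.exp_le_exp.2 h
      rw [← neg_mul] at this
      have := Real.exp_pos (lam * X)
      linarith
  have hprod : ∀ c : ℝ, c ^ 2 = 2 * t / A →
      ∑ σ : Fin n → Bool, ∏ i, Real.exp (c * (if σ i then - a i else a i)) ≤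
        2 ^ n * Real.exp t := by
    intro c hc
    have e := Finset.prod_univ_sum (fun _ : Fin n => (Finset.univ : Finset Bool))
      (fun i b => Real.exp (c * (if b then - a i else a i)))
    rw [Fintype.piFinset_univ] at e
    rw [← e]
    calc ∏ i, ∑ b : Bool, Real.exp (c * (if b then - a i else a i))
        ≤ ∏ i, (2 * Real.exp ((c * a i) ^ 2 / 2)) := by
          refine Finset.prod_le_prod (fun i _ => Finset.sum_nonneg fun _ _ => (Real.exp_pos _).le)
            fun i _ => ?_
          have := Real.cosh_le_exp_half_sq (c * a i)
          rw [Real.cosh_eq] at this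
          simp only [Fintype.sum_bool, if_true, Bool.false_eq_true, if_false, mul_neg]
          linarith
      _ = 2 ^ n * Real.exp t := by
          rw [Finset.prod_mul_distrib, ← Real.exp_sum]
          simp only [Finset.prod_const, Finset.card_univ, Fintype.card_fin, mul_pow, hc,
            ← Finset.mul_sum, ← Finset.sum_div, ← hA]
          congr 2
          field_simp
  have hsum : ((Finset.univ.filter fun σ : Fin n → Bool =>
      2 * t * A < (∑ i, (if σ i then - a i else a i)) ^ 2).card : ℝ) * Real.exp (2 * t) ≤
      2 * (2 ^ n * Real.exp t) := by
    rw [← nsmul_eq_mul, ← Finset.sum_const]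
    calc _ ≤ ∑ σ ∈ Finset.univ.filter (fun σ : Fin n → Bool =>
          2 * t * A < (∑ i, (if σ i then - a i else a i)) ^ 2),
          (∏ i, Real.exp (lam * (if σ i then - a i else a i)) +
          ∏ i, Real.exp (-lam * (if σ i then - a i else a i))) :=
          Finset.sum_le_sum fun σ hσ => key σ (Finset.mem_filter.1 hσ).2
      _ ≤ ∑ σ : Fin n → Bool, (∏ i, Real.exp (lam * (if σ i then - a i else a i)) +
          ∏ i, Real.exp (-lam * (if σ i then - a i else a i))) :=
          Finset.sum_le_sum_of_subset_of_nonneg (Finset.filter_subset _ _) fun _ _ _ => by positivity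
      _ ≤ _ := by
          rw [Finset.sum_add_distrib, two_mul]
          exact add_le_add (hprod _ hlam2) (hprod _ (by rw [neg_sq, hlam2]))
  rw [← le_div_iff₀ (Real.exp_pos _)] at hsum
  refine hsum.trans (le_of_eq ?_)
  rw [div_eq_mul_inv, ← Real.exp_neg, show -(2 * t) = -t + -t by ring, Real.exp_add,
    show 2 * (2 ^ n * Real.exp t) * (Real.exp (-t) * Real.exp (-t)) =
      2 * 2 ^ n * Real.exp (-t) * (Real.exp t * Real.exp (-t)) by ring, ← Real.exp_add]
  simp
  ring

/-! ### Tail bounds for a single function -/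

section tails
variable {Z : Type*} [MeasurableSpace Z] {P : Measure Z} [IsProbabilityMeasure P] {n : ℕ}

/-- The exponential Markov inequality for a sum of i.i.d. terms with values in `[-1, 1]`, with the
moment generating function bounded through `exp x ≤ 1 + x + x ^ 2`. -/
lemma pi_real_sum_ge_le {h : Z → ℝ} (hm : Measurable h) (h1 : ∀ z, |h z| ≤ 1) {b : ℝ}
    (hb : ∫ z, h z ∂P + ∫ z, h z ^ 2 ∂P ≤ b) (t : ℝ) :
    (Measure.pi fun _ : Fin n => P).real {S | n * b + t ≤ ∑ i, h (S i)} ≤ Real.exp (-t) := by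
  have hi : Integrable h P := Integrable.of_bound hm.aestronglyMeasurable 1 (.of_forall h1)
  have hi2 : Integrable (fun z => h z ^ 2) P :=
    Integrable.of_bound (hm.pow_const 2).aestronglyMeasurable 1 <| .of_forall fun z => by
      rw [Real.norm_eq_abs, abs_pow]
      exact pow_le_one₀ (abs_nonneg _) (h1 z)
  have hie : Integrable (fun z => Real.exp (h z)) P :=
    Integrable.of_bound hm.exp.aestronglyMeasurable (Real.exp 1) <| .of_forall fun z => by
      rw [Real.norm_eq_abs, Real.abs_exp]
      exact Real.exp_le_exp.2 ((le_abs_self _).trans (h1 z))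
  have hmgf : ∫ z, Real.exp (h z) ∂P ≤ Real.exp b := by
    calc ∫ z, Real.exp (h z) ∂P ≤ ∫ z, (1 + h z + h z ^ 2) ∂P := by
          refine integral_mono hie (((integrable_const 1).add hi).add hi2) fun z => ?_
          have := (abs_le.1 (Real.abs_exp_sub_one_sub_id_le (h1 z))).2
          simp only
          linarith
      _ = 1 + ∫ z, h z ∂P + ∫ z, h z ^ 2 ∂P := by
          rw [integral_add (f := fun z => 1 + h z) ((integrable_const 1).add hi) hi2, integral_add (integrable_const 1) hi]
          simp
      _ ≤ Real.exp b := by linarith [Real.add_one_le_exp b]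
  have hprod : ∫ S, ∏ i, Real.exp (h (S i)) ∂(Measure.pi fun _ : Fin n => P) ≤
      Real.exp (n * b) := by
    rw [integral_fintype_prod_eq_prod (μ := fun _ : Fin n => P)
      (f := fun _ z => Real.exp (h z))]
    simp only [Finset.prod_const, Finset.card_univ, Fintype.card_fin]
    rw [Real.exp_nat_mul]
    exact pow_le_pow_left₀ (integral_nonneg fun _ => (Real.exp_pos _).le) hmgf n
  have hint : Integrable (fun S : Fin n → Z => ∏ i, Real.exp (h (S i)))
      (Measure.pi fun _ : Fin n => P) :=
    Integrable.fintype_prod (f := fun _ z => Real.exp (h z)) fun _ => hie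
  have hmk := mul_meas_ge_le_integral_of_nonneg (μ := Measure.pi fun _ : Fin n => P)
    (.of_forall fun S => Finset.prod_nonneg fun i _ => (Real.exp_pos (h (S i))).le) hint
    (Real.exp (n * b + t))
  have hset : {S : Fin n → Z | Real.exp (n * b + t) ≤ ∏ i, Real.exp (h (S i))} =
      {S | n * b + t ≤ ∑ i, h (S i)} := by
    ext S
    simp only [Set.mem_ofPred_eq, ← Real.exp_sum, Real.exp_le_exp]
  rw [hset] at hmk
  rw [← mul_le_mul_iff_right₀ (Real.exp_pos (n * b + t)), ← Real.exp_add]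
  simpa using hmk.trans hprod

/-- The choice of exponent in Bernstein's inequality. -/
lemma exists_bernstein_exponent {M t a : ℝ} (hM : 0 < M) (ht : 0 < t) (ha : 0 ≤ a) :
    ∃ l : ℝ, 0 < l ∧ l * (2 * M) ≤ 1 ∧ l * a + t / l ≤ 2 * √(t * a) + 2 * M * t := by
  rcases le_or_gt a (4 * M ^ 2 * t) with h | h
  · refine ⟨1 / (2 * M), by positivity, le_of_eq (by field_simp), ?_⟩
    have h1 : a ≤ √(t * a) * (2 * M) := by
      have : √(t * a) * (2 * M) = √(t * a * (2 * M) ^ 2) := by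
        rw [Real.sqrt_mul (show 0 ≤ t * a by positivity), Real.sqrt_sq (by positivity)]
      rw [this]
      exact Real.le_sqrt_of_sq_le (by nlinarith)
    have h2 : 1 / (2 * M) * a ≤ √(t * a) := by
      rw [one_div, inv_mul_le_iff₀ (by positivity)]; linarith
    have h3 : t / (1 / (2 * M)) = 2 * M * t := by field_simp
    have := Real.sqrt_nonneg (t * a)
    linarith
  · have ha' : 0 < a := lt_of_le_of_lt (by positivity) h
    set s := √(t * a) with hs
    have hs0 : 0 < s := Real.sqrt_pos.2 (by positivity)
    have hs2 : s * s = t * a := Real.mul_self_sqrt (by positivity)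
    refine ⟨s / a, by positivity, ?_, ?_⟩
    · rw [div_mul_eq_mul_div, div_le_one ha']
      nlinarith
    · have h1 : s / a * a = s := by field_simp
      have h2 : t / (s / a) = s := by
        rw [div_div_eq_mul_div, ← hs2]; field_simp
      have : 0 ≤ 2 * M * t := by positivity
      linarith

variable {f : Z → ℝ} {M : ℝ}

lemma abs_integral_le_of_abs_le (hf1 : ∀ z, |f z| ≤ M) : |∫ z, f z ∂P| ≤ M := by
  have := norm_integral_le_of_norm_le_const (μ := P) (f := f) (C := M) (.of_forall hf1)
  simpa using this

lemma abs_sub_integral_le (hf1 : ∀ z, |f z| ≤ M) (z : Z) : |f z - ∫ z, f z ∂P| ≤ 2 * M := by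
  have h1 := abs_sub (f z) (∫ z, f z ∂P)
  have h2 := abs_integral_le_of_abs_le (P := P) hf1
  linarith [hf1 z]

lemma pi_real_bernstein (hM : 0 < M) (hf : Measurable f) (hf1 : ∀ z, |f z| ≤ M)
    {t : ℝ} (ht : 0 < t) :
    (Measure.pi fun _ : Fin n => P).real {S | 2 * √(t * (n * variance f P)) + 2 * M * t ≤
      ∑ i, f (S i) - n * ∫ z, f z ∂P} ≤ Real.exp (-t) := by
  have hV := variance_nonneg f P
  obtain ⟨l, hl, hl1, hl2⟩ := exists_bernstein_exponent hM ht
    (a := n * variance f P) (by positivity)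
  set m := ∫ z, f z ∂P with hm
  have hfi : Integrable f P := Integrable.of_bound hf.aestronglyMeasurable M (.of_forall hf1)
  refine le_trans (measureReal_mono ?_ (measure_ne_top _ _)) (pi_real_sum_ge_le (P := P) (n := n)
    (h := fun z => l * (f z - m)) ((hf.sub_const m).const_mul l) (fun z => ?_)
    (b := l ^ 2 * variance f P) ?_ t)
  · intro S hS
    simp only [Set.mem_ofPred_eq] at hS ⊢
    rw [← Finset.mul_sum, Finset.sum_sub_distrib]
    simp only [Finset.sum_const, Finset.card_univ, Fintype.card_fin, nsmul_eq_mul]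
    have h1 := mul_le_mul_of_nonneg_left (hl2.trans hS) hl.le
    have h2 : l * (l * (n * variance f P) + t / l) = n * (l ^ 2 * variance f P) + t := by
      field_simp
    linarith
  · rw [abs_mul, abs_of_pos hl]
    exact (mul_le_mul_of_nonneg_left (abs_sub_integral_le hf1 z) hl.le).trans hl1
  · apply le_of_eq
    rw [variance_eq_integral hf.aemeasurable, integral_const_mul,
      integral_sub hfi (integrable_const _)]
    simp only [mul_pow, integral_const_mul]
    simp [hm]

lemma pi_real_bernstein_lower (hM : 0 < M) (hf : Measurable f) (hf1 : ∀ z, |f z| ≤ M)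
    {t : ℝ} (ht : 0 < t) :
    (Measure.pi fun _ : Fin n => P).real {S | 2 * √(t * (n * variance f P)) + 2 * M * t ≤
      n * ∫ z, f z ∂P - ∑ i, f (S i)} ≤ Real.exp (-t) := by
  have := pi_real_bernstein (P := P) (n := n) (f := fun z => - f z) hM hf.neg
    (fun z => by rw [abs_neg]; exact hf1 z) ht
  have e : variance (fun z => - f z) P = variance f P := variance_fun_neg
  simp only [e, integral_neg, Finset.sum_neg_distrib] at this
  convert this using 5
  ring

lemma sq_sub_integral_le (hf1 : ∀ z, |f z| ≤ M) (z : Z) :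
    (f z - ∫ z, f z ∂P) ^ 2 ≤ 4 * M ^ 2 := by
  have := abs_le.1 (abs_sub_integral_le (P := P) hf1 z)
  nlinarith

lemma integral_pow_four_le (hf : Measurable f) (hf1 : ∀ z, |f z| ≤ M) :
    ∫ z, ((f z - ∫ z, f z ∂P) ^ 2) ^ 2 ∂P ≤ 4 * M ^ 2 * variance f P := by
  set m := ∫ z, f z ∂P with hm
  rw [variance_eq_integral hf.aemeasurable, ← integral_const_mul, ← hm]
  refine integral_mono
    (Integrable.of_bound (((hf.sub_const m).pow_const 2).pow_const 2).aestronglyMeasurable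
      ((4 * M ^ 2) ^ 2) (.of_forall fun z => ?_))
    (Integrable.of_bound (((hf.sub_const m).pow_const 2).const_mul _).aestronglyMeasurable
      ((4 * M ^ 2) * (4 * M ^ 2)) (.of_forall fun z => ?_)) fun z => ?_
  · rw [Real.norm_eq_abs, abs_of_nonneg (by positivity)]
    exact pow_le_pow_left₀ (by positivity) (sq_sub_integral_le hf1 z) 2
  · rw [Real.norm_eq_abs, abs_of_nonneg (by positivity)]
    exact mul_le_mul_of_nonneg_left (sq_sub_integral_le hf1 z) (by positivity)
  · simp only
    rw [pow_two ((f z - m) ^ 2)]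
    exact mul_le_mul_of_nonneg_right (sq_sub_integral_le hf1 z) (by positivity)

lemma pi_real_sum_sq_ge_le (hM : 0 < M) (hf : Measurable f) (hf1 : ∀ z, |f z| ≤ M) (t : ℝ) :
    (Measure.pi fun _ : Fin n => P).real {S | 2 * (n * variance f P) + 4 * M ^ 2 * t ≤
      ∑ i, (f (S i) - ∫ z, f z ∂P) ^ 2} ≤ Real.exp (-t) := by
  have h4 := integral_pow_four_le (P := P) hf hf1
  have hVe := variance_eq_integral (μ := P) hf.aemeasurable
  set m := ∫ z, f z ∂P with hm
  set V := variance f P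
  refine le_trans (measureReal_mono ?_ (measure_ne_top _ _)) (pi_real_sum_ge_le (P := P) (n := n)
    (h := fun z => 1 / (4 * M ^ 2) * (f z - m) ^ 2) (((hf.sub_const m).pow_const 2).const_mul _)
    (fun z => ?_) (b := 2 * V / (4 * M ^ 2)) ?_ t)
  · intro S hS
    simp only [Set.mem_ofPred_eq] at hS ⊢
    rw [← Finset.mul_sum, one_div, ← div_eq_inv_mul, le_div_iff₀ (by positivity)]
    refine le_trans (le_of_eq ?_) hS
    field_simp
  · rw [abs_of_nonneg (by positivity), one_div, inv_mul_le_one₀ (by positivity)]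
    exact sq_sub_integral_le hf1 z
  · simp only [mul_pow (1 / (4 * M ^ 2)), integral_const_mul]
    rw [← hVe]
    calc _ ≤ 1 / (4 * M ^ 2) * V + (1 / (4 * M ^ 2)) ^ 2 * (4 * M ^ 2 * V) := by gcongr
      _ = _ := by field_simp; ring

lemma pi_real_sum_sq_le_le (hM : 0 < M) (hf : Measurable f) (hf1 : ∀ z, |f z| ≤ M) (t : ℝ) :
    (Measure.pi fun _ : Fin n => P).real {S | ∑ i, (f (S i) - ∫ z, f z ∂P) ^ 2 ≤
      n * variance f P / 2 - 8 * M ^ 2 * t} ≤ Real.exp (-t) := by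
  have h4 := integral_pow_four_le (P := P) hf hf1
  have hVe := variance_eq_integral (μ := P) hf.aemeasurable
  set m := ∫ z, f z ∂P with hm
  set V := variance f P
  refine le_trans (measureReal_mono ?_ (measure_ne_top _ _)) (pi_real_sum_ge_le (P := P) (n := n)
    (h := fun z => -1 / (8 * M ^ 2) * (f z - m) ^ 2) (((hf.sub_const m).pow_const 2).const_mul _)
    (fun z => ?_) (b := - (V / 2) / (8 * M ^ 2)) ?_ t)
  · intro S hS
    simp only [Set.mem_ofPred_eq] at hS ⊢
    rw [← Finset.mul_sum, div_mul_eq_mul_div, le_div_iff₀ (by positivity)]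
    have e : (n * (-(V / 2) / (8 * M ^ 2)) + t) * (8 * M ^ 2) =
        - (n * V / 2 - 8 * M ^ 2 * t) := by
      field_simp; ring
    linarith
  · rw [neg_div, neg_mul, abs_neg, abs_of_nonneg (by positivity), one_div,
      inv_mul_le_one₀ (by positivity)]
    have := sq_sub_integral_le (P := P) hf1 z
    nlinarith [sq_nonneg M]
  · simp only [mul_pow (-1 / (8 * M ^ 2)), integral_const_mul]
    rw [← hVe]
    calc _ ≤ -1 / (8 * M ^ 2) * V + (-1 / (8 * M ^ 2)) ^ 2 * (4 * M ^ 2 * V) := by gcongr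
      _ = _ := by field_simp; ring

end tails

/-! ### Rounding a class of finite VC-dimension -/

/-- A bound for the number of sets of at most `d` elements that is simpler than the usual
`(e N / d) ^ d` and has no exceptional cases. -/
lemma sum_choose_le_pow (N d : ℕ) : ∑ k ∈ Finset.Iic d, N.choose k ≤ (N + 1) ^ d := by
  induction d with
  | zero =>
    have : Finset.Iic 0 = {0} := rfl
    simp [this]
  | succ d ih =>
    have h1 : Finset.Iic (d + 1) = insert (d + 1) (Finset.Iic d) := by
      ext; simp; omega
    rw [h1, Finset.sum_insert (by simp), pow_succ, mul_add, mul_one]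
    have h2 : N.choose (d + 1) ≤ (N + 1) ^ d * N :=
      (Nat.choose_le_pow N (d + 1)).trans <| by
        rw [pow_succ]
        exact Nat.mul_le_mul_right _ (Nat.pow_le_pow_left (Nat.le_succ N) d)
    omega

/-- The Sauer–Shelah lemma for the traces of a family of sets on an indexed finite family of
points, which need not be distinct: a shattered set of indices has distinct points. -/
lemma card_traces_le {α κ : Type*} [Fintype κ] [DecidableEq κ] {C : Set (Set α)} {d : ℕ}
    (hC : setVCDim C ≤ d) (g : κ → α) (T : Finset (Finset κ))
    (hT : ∀ s ∈ T, ∃ A ∈ C, ∀ k, k ∈ s ↔ g k ∈ A) :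
    T.card ≤ (Fintype.card κ + 1) ^ d := by
  classical
  have hvc : T.vcDim ≤ d := by
    refine Finset.sup_le fun s hs => ?_
    rw [Finset.mem_shatterer] at hs
    have hinj : Set.InjOn g s := by
      intro a ha b hb hab
      obtain ⟨u, hu, hsu⟩ := hs (t := {a}) (by simpa using ha)
      obtain ⟨A, -, hA⟩ := hT u hu
      have h1 : a ∈ s ∩ u := by rw [hsu]; simp
      have h2 : b ∈ s ∩ u := Finset.mem_inter.2 ⟨hb, (hA b).2 (hab ▸ (hA a).1
        (Finset.mem_inter.1 h1).2)⟩
      rw [hsu, Finset.mem_singleton] at h2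
      exact h2.symm
    have hsh : Shatters C (s.image g) := by
      intro t ht
      obtain ⟨u, hu, hsu⟩ := hs (t := s.filter fun k => g k ∈ t) (Finset.filter_subset _ _)
      obtain ⟨A, hAC, hA⟩ := hT u hu
      refine ⟨A, hAC, ?_⟩
      have hk : ∀ k ∈ s, g k ∈ A ↔ g k ∈ t := by
        intro k hks
        have := congrArg (k ∈ ·) hsu
        simpa [hks, hA] using this
      ext y
      constructor
      · rintro ⟨hy, hyA⟩
        obtain ⟨k, hks, rfl⟩ := Finset.mem_image.1 (Finset.mem_coe.1 hy)
        exact (hk k hks).1 hyA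
      · intro hy
        refine ⟨ht hy, ?_⟩
        obtain ⟨k, hks, rfl⟩ := Finset.mem_image.1 (Finset.mem_coe.1 (ht hy))
        exact (hk k hks).2 hy
    have h1 : ((s.image g).card : ℕ∞) ≤ setVCDim C := le_iSup₂_of_le (s.image g) hsh le_rfl
    rw [Finset.card_image_of_injOn hinj] at h1
    exact_mod_cast h1.trans hC
  calc T.card ≤ T.shatterer.card := Finset.card_le_card_shatterer T
    _ ≤ ∑ k ∈ Finset.Iic T.vcDim, (Fintype.card κ).choose k := Finset.card_shatterer_le_sum_vcDim
    _ ≤ ∑ k ∈ Finset.Iic d, (Fintype.card κ).choose k :=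
        Finset.sum_le_sum_of_subset (Finset.Iic_subset_Iic.2 hvc)
    _ ≤ _ := sum_choose_le_pow _ _

/-- A class of functions bounded by `M` with VC-dimension at most `d` takes at most
`(2 |ι| m + 1) ^ d` values on the points `x`, once the values are rounded up to multiples of
`M / m`: the rounded values are determined by the trace of the subgraph on the grid of the points
`(x j, k M / m)` with `-m ≤ k < m`. -/
lemma exists_rounding {Z ι : Type*} [Fintype ι] {F : Set (Z → ℝ)} {d : ℕ} (hF : vcDim F ≤ d)
    {M : ℝ} (hM : 0 < M) {m : ℕ} (hm : 0 < m) (hFM : ∀ f ∈ F, ∀ z, |f z| ≤ M) (x : ι → Z) :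
    ∃ Y : Finset (ι → ℝ), Y.card ≤ (2 * Fintype.card ι * m + 1) ^ d ∧
      (∀ y ∈ Y, ∀ j, |y j| ≤ M) ∧
      ∀ f ∈ F, ∃ y ∈ Y, ∀ j, |y j - f (x j)| ≤ M / m := by
  classical
  have hm' : (0 : ℝ) < m := by exact_mod_cast hm
  set e : ℝ := M / m with he
  have he0 : 0 < e := by positivity
  let r : (Z → ℝ) → ι → ℤ := fun f j => ⌈f (x j) / e⌉
  have hr1 : ∀ f ∈ F, ∀ j, -(m : ℤ) ≤ r f j ∧ r f j ≤ m := by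
    intro f hf j
    have h1 := abs_le.1 (hFM f hf (x j))
    have h2 : (m : ℝ) * e = M := by rw [he]; field_simp
    constructor
    · have h3 : ((-(m : ℤ) : ℤ) : ℝ) ≤ f (x j) / e := by
        rw [le_div_iff₀ he0]; push_cast; linarith
      exact_mod_cast h3.trans (Int.le_ceil _)
    · apply Int.ceil_le.2
      rw [div_le_iff₀ he0]; push_cast; linarith
  let κ := ι × Fin (2 * m)
  let g : κ → Z × ℝ := fun k => (x k.1, ((k.2 : ℕ) - (m : ℤ) : ℤ) * e)
  let tr : (Z → ℝ) → Finset κ := fun f => Finset.univ.filter fun k => g k ∈ subgraph f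
  have htr : ∀ f k, k ∈ tr f ↔ ((k.2 : ℕ) - (m : ℤ) : ℤ) < r f k.1 := by
    intro f k
    have h1 : k ∈ tr f ↔ g k ∈ subgraph f := by simp [tr]
    rw [h1, Int.lt_ceil, lt_div_iff₀ he0]
    exact Iff.rfl
  have hinj : ∀ f ∈ F, ∀ f' ∈ F, tr f = tr f' → r f = r f' := by
    have hle : ∀ f ∈ F, ∀ f' ∈ F, tr f = tr f' → ∀ j, r f j ≤ r f' j := by
      intro f hf f' hf' h j
      by_contra! hlt
      have b1 := hr1 f hf j
      have b2 := hr1 f' hf' j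
      obtain ⟨k, hk⟩ : ∃ k : ℕ, (k : ℤ) = r f' j + m := ⟨(r f' j + m).toNat, by omega⟩
      have hk2 : k < 2 * m := by omega
      have h1 : ((j, ⟨k, hk2⟩) : κ) ∈ tr f := (htr f _).2 (by simp only; omega)
      rw [h, htr f'] at h1
      simp only at h1
      omega
    intro f hf f' hf' h
    exact funext fun j => le_antisymm (hle f hf f' hf' h j) (hle f' hf' f hf h.symm j)
  -- one representative for each trace
  let T : Finset (Finset κ) := Finset.univ.filter fun s => ∃ f ∈ F, tr f = s
  have hTr : ∀ s : T, ∃ f ∈ F, tr f = s := fun s => (Finset.mem_filter.1 s.2).2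
  choose rep hrepF hrep using hTr
  refine ⟨T.attach.image fun s j => (r (rep s) j : ℝ) * e, ?_, ?_, ?_⟩
  · refine Finset.card_image_le.trans ?_
    rw [Finset.card_attach]
    have := card_traces_le (C := subgraph '' F) hF g T (by
      intro s hs
      obtain ⟨f, hf, rfl⟩ := (Finset.mem_filter.1 hs).2
      exact ⟨_, ⟨f, hf, rfl⟩, fun k => by simp [tr]⟩)
    refine this.trans (le_of_eq ?_)
    simp only [κ, Fintype.card_prod, Fintype.card_fin]
    congr 2
    ring
  · intro y hy j
    obtain ⟨s, -, rfl⟩ := Finset.mem_image.1 hy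
    have b := hr1 _ (hrepF s) j
    have b1 : (-(m : ℝ)) ≤ r (rep s) j := by exact_mod_cast b.1
    have b2 : (r (rep s) j : ℝ) ≤ m := by exact_mod_cast b.2
    have h2 : (m : ℝ) * e = M := by rw [he]; field_simp
    simp only
    rw [← h2, abs_mul, abs_of_pos he0]
    exact mul_le_mul_of_nonneg_right (abs_le.2 ⟨b1, b2⟩) he0.le
  · intro f hf
    have hfT : tr f ∈ T := Finset.mem_filter.2 ⟨Finset.mem_univ _, f, hf, rfl⟩
    refine ⟨_, Finset.mem_image.2 ⟨⟨tr f, hfT⟩, Finset.mem_attach _ _, rfl⟩, fun j => ?_⟩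
    rw [hinj _ (hrepF ⟨tr f, hfT⟩) f hf (hrep ⟨tr f, hfT⟩)]
    have c1 := Int.le_ceil (f (x j) / e)
    have c2 := Int.ceil_lt_add_one (f (x j) / e)
    rw [div_le_iff₀ he0] at c1
    rw [← sub_lt_iff_lt_add, lt_div_iff₀ he0] at c2
    rw [abs_le]
    constructor <;> simp only [r] <;> linarith

/-! ### Exchanges between two fixed samples -/

/-- The deterministic core of the symmetrization argument: if the differences `y' - y`, and those
of the squared deviations from the joint mean, have sums of the size of a typical random signed
sum, then both the difference of the sums and the spread of `y'` are controlled by the spread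
of `y`. Here `T` is the joint sum of squared deviations. -/
lemma exists_joint_spread {n : ℕ} (hn : 0 < n) {y y' : Fin n → ℝ} {M t c : ℝ} (ht : 0 < t)
    (hnt : 75 * t ≤ n) (hy : ∀ i, |y i| ≤ M) (hy' : ∀ i, |y' i| ≤ M)
    (hc : c = (mean y + mean y') / 2)
    (h1 : (∑ i, (y' i - y i)) ^ 2 ≤ 2 * t * ∑ i, (y' i - y i) ^ 2)
    (h2 : (∑ i, ((y' i - c) ^ 2 - (y i - c) ^ 2)) ^ 2 ≤
      2 * t * ∑ i, ((y' i - c) ^ 2 - (y i - c) ^ 2) ^ 2) :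
    ∃ T, ssd y' ≤ T ∧ (∑ i, (y' i - y i)) ^ 2 ≤ 4 * t * T ∧
      T ≤ 9 / 4 * ssd y + 40 * M ^ 2 * t := by
  have hn' : (0 : ℝ) < n := by exact_mod_cast hn
  have hbd : ∀ {x : Fin n → ℝ}, (∀ i, |x i| ≤ M) → ∀ i, (x i - c) ^ 2 ≤ 4 * M ^ 2 := by
    intro x hx i
    have a1 := abs_le.1 (hx i)
    have a2 := abs_le.1 (abs_mean_le hn hy)
    have a3 := abs_le.1 (abs_mean_le hn hy')
    nlinarith
  set A := ∑ i, (y i - c) ^ 2 with hA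
  set B := ∑ i, (y' i - c) ^ 2 with hB
  have hA0 : 0 ≤ A := Finset.sum_nonneg fun _ _ => sq_nonneg _
  have hB0 : 0 ≤ B := Finset.sum_nonneg fun _ _ => sq_nonneg _
  have hD : ∑ i, (y' i - y i) ^ 2 ≤ 2 * (A + B) := by
    rw [hA, hB, ← Finset.sum_add_distrib, Finset.mul_sum]
    refine Finset.sum_le_sum fun i _ => ?_
    nlinarith [sq_nonneg (y' i - c + (y i - c))]
  have hU : ∑ i, ((y' i - c) ^ 2 - (y i - c) ^ 2) ^ 2 ≤ 4 * M ^ 2 * (A + B) := by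
    rw [hA, hB, ← Finset.sum_add_distrib, Finset.mul_sum]
    refine Finset.sum_le_sum fun i _ => ?_
    nlinarith [hbd hy i, hbd hy' i, sq_nonneg (y i - c), sq_nonneg (y' i - c)]
  rw [Finset.sum_sub_distrib, ← hA, ← hB] at h2
  have hD2 : (∑ i, (y' i - y i)) ^ 2 ≤ 4 * t * (A + B) :=
    h1.trans (by nlinarith)
  have hU2 : (B - A) ^ 2 ≤ 8 * M ^ 2 * t * (A + B) :=
    h2.trans (by nlinarith)
  refine ⟨A + B, ?_, hD2, ?_⟩
  · have := ssd_le_sum_sub_sq hn y' c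
    linarith
  -- the joint mean is close to the mean of `y`
  have hm : n * (mean y - c) ^ 2 ≤ (A + B) / 75 := by
    have e1 : n * (mean y - c) = -(∑ i, (y' i - y i)) / 2 := by
      rw [Finset.sum_sub_distrib, sum_eq_mul_mean hn, sum_eq_mul_mean hn, hc]; ring
    have e2 : n * (n * (mean y - c) ^ 2) = (∑ i, (y' i - y i)) ^ 2 / 4 := by
      rw [show (n : ℝ) * (n * (mean y - c) ^ 2) = (n * (mean y - c)) ^ 2 by ring, e1]; ring
    have e3 : n * (n * (mean y - c) ^ 2) ≤ n * ((A + B) / 75) := by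
      rw [e2]; nlinarith
    exact le_of_mul_le_mul_left e3 hn'
  have hAs := sum_sub_sq_eq hn y c
  rw [← hA] at hAs
  -- `B - A ≤ √(8 M² t (A + B))`, split by the inequality of arithmetic and geometric means
  have hBA : B - A ≤ (A + B) / 15 + 30 * M ^ 2 * t := by
    have hs : 0 ≤ (A + B) / 15 + 30 * M ^ 2 * t := by positivity
    apply le_of_sq_le_sq _ hs
    nlinarith [sq_nonneg ((A + B) / 15 - 30 * M ^ 2 * t)]
  have : 0 ≤ M ^ 2 * t := by positivity
  have := ssd_nonneg y
  linarith

lemma ssd_le_of_abs_sub_le {n : ℕ} (hn : 0 < n) {x y : Fin n → ℝ} {e : ℝ}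
    (h : ∀ i, |y i - x i| ≤ e) : ssd y ≤ 11 / 10 * ssd x + 11 * (n * e ^ 2) := by
  refine (ssd_le_sum_sub_sq hn y (mean x)).trans ?_
  rw [ssd, Finset.mul_sum]
  have : 11 * (n * e ^ 2) = ∑ _i : Fin n, 11 * e ^ 2 := by simp; ring
  rw [this, ← Finset.sum_add_distrib]
  refine Finset.sum_le_sum fun i _ => ?_
  have h1 : (y i - x i) ^ 2 ≤ e ^ 2 := sq_le_sq' (abs_le.1 (h i)).1 (abs_le.1 (h i)).2
  nlinarith [sq_nonneg ((x i - mean x) - 10 * (y i - x i))]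

/-- The numerical part of the two-sample comparison: `D` and `D'` stand for the differences of the
sums of the rounded and the original values, `s₀`, `s₁` for the spreads of the original values,
`r₀`, `r₁` for those of the rounded ones. -/
lemma two_sample_numerics {M t ρ T s₀ s₁ r₀ r₁ D D' : ℝ} (hM : 0 < M) (ht : 100 ≤ t)
    (hρ : 9 * t ≤ ρ) (hs0 : 0 ≤ s₀) (hr1 : r₁ ≤ T) (hD : D ^ 2 ≤ 4 * t * T)
    (hT : T ≤ 9 / 4 * r₀ + 40 * M ^ 2 * t) (hr0 : r₀ ≤ 11 / 10 * s₀ + 11 * M ^ 2)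
    (hs1 : s₁ ≤ 11 / 10 * r₁ + 11 * M ^ 2) (hD' : D' ≤ D + 2 * M) :
    D' + √(17 * s₁) + 25 * M ≤ √(2 * ρ * s₀) + 5 * M * ρ := by
  have ht0 : 0 < t := by linarith
  have hMt : M ^ 2 * 100 ≤ M ^ 2 * t := mul_le_mul_of_nonneg_left ht (sq_nonneg M)
  have hM2 : 0 ≤ M ^ 2 := sq_nonneg M
  have hT4 : T ≤ 2.475 * s₀ + 41 * (M ^ 2 * t) := by linarith
  have hs' : s₁ ≤ 2.73 * s₀ + 45.25 * (M ^ 2 * t) := by linarith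
  set w := √(t * s₀) with hw
  have hw0 : 0 ≤ w := Real.sqrt_nonneg _
  have hw2 : w ^ 2 = t * s₀ := Real.sq_sqrt (by positivity)
  have hMt0 : 0 ≤ M * t := by positivity
  have hwM : 0 ≤ w * (M * t) := by positivity
  have b1 : D ≤ 3.15 * w + 13 * (M * t) := by
    apply le_of_sq_le_sq _ (by positivity)
    have : t * T ≤ t * (2.475 * s₀ + 41 * (M ^ 2 * t)) := mul_le_mul_of_nonneg_left hT4 ht0.le
    nlinarith only [this, hw2, hwM, hD, sq_nonneg (M * t), sq_nonneg w]
  have b2 : √(17 * s₁) ≤ 0.7 * w + 2.8 * (M * t) := by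
    rw [Real.sqrt_le_iff]
    refine ⟨by positivity, ?_⟩
    have c1 : 100 * s₀ ≤ t * s₀ := mul_le_mul_of_nonneg_right ht hs0
    have c2 : (M ^ 2 * t) * 100 ≤ (M ^ 2 * t) * t := mul_le_mul_of_nonneg_left ht (by positivity)
    nlinarith only [c1, c2, hw2, hwM, hs']
  have b3 : 4 * w ≤ √(2 * ρ * s₀) := by
    apply Real.le_sqrt_of_sq_le
    rw [mul_pow, hw2]
    have : 9 * t * s₀ ≤ ρ * s₀ := mul_le_mul_of_nonneg_right hρ hs0
    have : 0 ≤ t * s₀ := by positivity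
    linarith
  have b5 : M * (9 * t) ≤ M * ρ := mul_le_mul_of_nonneg_left hρ hM.le
  have b6 : M * 100 ≤ M * t := mul_le_mul_of_nonneg_left ht hM.le
  linarith

/-- The two-sample comparison whose failure has small probability uniformly over the class. -/
lemma sum_sub_le_of_rounding {n : ℕ} (hn : 0 < n) {x x' y y' : Fin n → ℝ} {M t ρ c : ℝ}
    (hM : 0 < M) (ht : 100 ≤ t) (hnt : 75 * t ≤ n) (hρ : 9 * t ≤ ρ)
    (hy : ∀ i, |y i| ≤ M) (hy' : ∀ i, |y' i| ≤ M)
    (hyx : ∀ i, |y i - x i| ≤ M / n) (hyx' : ∀ i, |y' i - x' i| ≤ M / n)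
    (hc : c = (mean y + mean y') / 2)
    (h1 : (∑ i, (y' i - y i)) ^ 2 ≤ 2 * t * ∑ i, (y' i - y i) ^ 2)
    (h2 : (∑ i, ((y' i - c) ^ 2 - (y i - c) ^ 2)) ^ 2 ≤
      2 * t * ∑ i, ((y' i - c) ^ 2 - (y i - c) ^ 2) ^ 2) :
    ∑ i, x' i - ∑ i, x i + √(17 * ssd x') + 25 * M ≤ √(2 * ρ * ssd x) + 5 * M * ρ := by
  have hn1 : (1 : ℝ) ≤ n := by exact_mod_cast hn
  obtain ⟨T, hT1, hT2, hT3⟩ := exists_joint_spread hn (by linarith) hnt hy hy' hc h1 h2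
  have hround : (n : ℝ) * (M / n) ^ 2 ≤ M ^ 2 := by
    rw [show (n : ℝ) * (M / n) ^ 2 = M ^ 2 / n by field_simp]
    exact div_le_self (sq_nonneg M) hn1
  have s1 := ssd_le_of_abs_sub_le hn hyx
  have s2 := ssd_le_of_abs_sub_le hn (x := y') (y := x') fun i => by
    rw [abs_sub_comm]; exact hyx' i
  refine two_sample_numerics hM ht hρ (ssd_nonneg x) hT1 hT2 hT3
    (s1.trans (by gcongr)) (s2.trans (by gcongr)) ?_
  have : ∀ i, x' i - x i ≤ (y' i - y i) + 2 * (M / n) := by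
    intro i
    linarith [(abs_le.1 (hyx i)).2, (abs_le.1 (hyx' i)).1]
  rw [← Finset.sum_sub_distrib]
  refine (Finset.sum_le_sum fun i _ => this i).trans (le_of_eq ?_)
  rw [Finset.sum_add_distrib]
  simp
  field_simp

/-- For fixed samples `x` and `x'`, few exchanges of entries between them violate the two-sample
comparison for some function of the class. -/
lemma card_exchanges_le {Z : Type*} {F : Set (Z → ℝ)} {d : ℕ} (hF : vcDim F ≤ d)
    {M t ρ : ℝ} (hM : 0 < M) (hFM : ∀ f ∈ F, ∀ z, |f z| ≤ M) {n : ℕ} (hn : 0 < n)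
    (ht : 100 ≤ t) (hnt : 75 * t ≤ n) (hρ : 9 * t ≤ ρ) (x x' : Fin n → Z)
    (B : Finset (Fin n → Bool))
    (hB : ∀ σ ∈ B, ∃ f ∈ F, √(2 * ρ * ssd fun i => f (if σ i then x' i else x i)) + 5 * M * ρ <
      ∑ i, f (if σ i then x i else x' i) - ∑ i, f (if σ i then x' i else x i) +
        √(17 * ssd fun i => f (if σ i then x i else x' i)) + 25 * M) :
    (B.card : ℝ) ≤ (4 * (n : ℝ) ^ 2 + 1) ^ d * (4 * Real.exp (-t)) * 2 ^ n := by
  classical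
  obtain ⟨Y, hYc, hYM, hY⟩ := exists_rounding hF hM hn hFM (Sum.elim x x')
  -- for a rounded function the exchanges act on both difference vectors by changes of sign
  let bad : (Fin n → ℝ) → Finset (Fin n → Bool) := fun a => Finset.univ.filter fun σ =>
      2 * t * ∑ i, a i ^ 2 < (∑ i, (if σ i then - a i else a i)) ^ 2
  let c : (Fin n ⊕ Fin n → ℝ) → ℝ := fun y =>
    (mean (fun i => y (.inl i)) + mean fun i => y (.inr i)) / 2
  let a₁ : (Fin n ⊕ Fin n → ℝ) → Fin n → ℝ := fun y i => y (.inr i) - y (.inl i)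
  let a₂ : (Fin n ⊕ Fin n → ℝ) → Fin n → ℝ := fun y i =>
    (y (.inr i) - c y) ^ 2 - (y (.inl i) - c y) ^ 2
  have hsub : B ⊆ Y.biUnion fun y => bad (a₁ y) ∪ bad (a₂ y) := by
    intro σ hσ
    obtain ⟨f, hf, hfσ⟩ := hB σ hσ
    obtain ⟨y, hy, hyf⟩ := hY f hf
    rw [Finset.mem_biUnion]
    refine ⟨y, hy, ?_⟩
    by_contra hcon
    simp only [bad, Finset.mem_union, Finset.mem_filter, Finset.mem_univ, true_and, not_or,
      not_lt] at hcon
    obtain ⟨g1, g2⟩ := hcon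
    refine absurd hfσ (not_lt.2 ?_)
    refine sum_sub_le_of_rounding hn (c := c y) hM ht hnt hρ
      (y := fun i => if σ i then y (.inr i) else y (.inl i))
      (y' := fun i => if σ i then y (.inl i) else y (.inr i)) ?_ ?_ ?_ ?_ ?_ ?_ ?_
    · intro i; split_ifs <;> exact hYM y hy _
    · intro i; split_ifs <;> exact hYM y hy _
    · intro i; split_ifs
      · exact hyf (.inr i)
      · exact hyf (.inl i)
    · intro i; split_ifs
      · exact hyf (.inl i)
      · exact hyf (.inr i)
    · simp only [c, mean, ← add_div, ← Finset.sum_add_distrib]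
      congr 2
      refine Finset.sum_congr rfl fun i _ => ?_
      split_ifs <;> ring
    · refine le_of_eq_of_le (congrArg (· ^ 2) (Finset.sum_congr rfl fun i _ => ?_))
        (g1.trans_eq (congrArg (2 * t * ·) (Finset.sum_congr rfl fun i _ => ?_))) <;>
      simp only [a₁] <;> split_ifs <;> ring
    · refine le_of_eq_of_le (congrArg (· ^ 2) (Finset.sum_congr rfl fun i _ => ?_))
        (g2.trans_eq (congrArg (2 * t * ·) (Finset.sum_congr rfl fun i _ => ?_))) <;>
      simp only [a₂] <;> split_ifs <;> ring
  have ht0 : 0 ≤ t := by linarith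
  have hcard : (B.card : ℝ) ≤ ∑ y ∈ Y, (2 * Real.exp (-t) * 2 ^ n + 2 * Real.exp (-t) * 2 ^ n) := by
    have h1 : B.card ≤ ∑ y ∈ Y, ((bad (a₁ y)).card + (bad (a₂ y)).card) :=
      (Finset.card_le_card hsub).trans <| Finset.card_biUnion_le.trans <|
        Finset.sum_le_sum fun y _ => Finset.card_union_le _ _
    calc (B.card : ℝ) ≤ ∑ y ∈ Y, (((bad (a₁ y)).card : ℝ) + (bad (a₂ y)).card) := by
          exact_mod_cast h1
      _ ≤ _ := Finset.sum_le_sum fun y _ =>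
          add_le_add (card_signs_le (a₁ y) ht0) (card_signs_le (a₂ y) ht0)
  refine hcard.trans ?_
  rw [Finset.sum_const, nsmul_eq_mul]
  have hYc' : (Y.card : ℝ) ≤ (4 * (n : ℝ) ^ 2 + 1) ^ d := by
    have : ((Y.card : ℕ) : ℝ) ≤ (((2 * Fintype.card (Fin n ⊕ Fin n) * n + 1) ^ d : ℕ) : ℝ) := by
      exact_mod_cast hYc
    refine this.trans (le_of_eq ?_)
    simp only [Fintype.card_sum, Fintype.card_fin]
    push_cast
    ring
  calc (Y.card : ℝ) * (2 * Real.exp (-t) * 2 ^ n + 2 * Real.exp (-t) * 2 ^ n)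
      ≤ (4 * (n : ℝ) ^ 2 + 1) ^ d * (2 * Real.exp (-t) * 2 ^ n + 2 * Real.exp (-t) * 2 ^ n) := by
        gcongr
    _ = _ := by ring

/-! ### Consequences for samples and symmetrization -/

section samples
variable {Z : Type*} [MeasurableSpace Z] {P : Measure Z} [IsProbabilityMeasure P] {n : ℕ}
  {f : Z → ℝ} {M : ℝ}

/-- For a single function the empirical upper bound exceeds its population counterpart by little:
Bernstein's inequality for `f` and for `(f - 𝔼 f) ^ 2`. -/
lemma pi_real_empirical_gt_le (hn : 0 < n) (hM : 0 < M) (hf : Measurable f)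
    (hf1 : ∀ z, |f z| ≤ M) {t ρ : ℝ} (ht : 0 < t) (hρ : 9 * t ≤ ρ) :
    (Measure.pi fun _ : Fin n => P).real {S | n * ∫ z, f z ∂P +
      2 * √(2 * ρ * (n * variance f P)) + 2 * M * ρ <
      ∑ i, f (S i) + √(2 * ρ * ssd fun i => f (S i))} ≤ 2 * Real.exp (-t) := by
  have hV : 0 ≤ n * variance f P := mul_nonneg (Nat.cast_nonneg n) (variance_nonneg f P)
  have h1 := pi_real_bernstein (P := P) (n := n) hM hf hf1 ht
  have h2 := pi_real_sum_sq_ge_le (P := P) (n := n) hM hf hf1 t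
  set m := ∫ z, f z ∂P
  set v := n * variance f P
  refine le_trans (measureReal_mono (fun S hS => ?_) (measure_ne_top _ _)) <|
    (measureReal_union_le _ _).trans <| (add_le_add h1 h2).trans (by linarith)
  by_contra hcon
  simp only [Set.mem_union, Set.mem_ofPred_eq, not_or, not_le] at hcon hS
  obtain ⟨g1, g2⟩ := hcon
  have g3 := ssd_le_sum_sub_sq hn (fun i => f (S i)) m
  set s := ssd fun i => f (S i)
  have hρ0 : 0 < ρ := by linarith
  set w := √(ρ * v) with hw
  have hw0 : 0 ≤ w := Real.sqrt_nonneg _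
  have hw2 : w ^ 2 = ρ * v := Real.sq_sqrt (by positivity)
  have c1 : √(t * v) ≤ w / 3 := by
    rw [Real.sqrt_le_iff]
    refine ⟨by positivity, ?_⟩
    rw [div_pow, hw2]
    nlinarith
  have c2 : √(2 * ρ * s) ≤ 2 * w + M * ρ := by
    rw [Real.sqrt_le_iff]
    refine ⟨by positivity, ?_⟩
    have e1 : 2 * ρ * s ≤ 2 * ρ * (2 * v + 4 * M ^ 2 * t) := by gcongr; linarith
    have e2 : 8 * (M ^ 2 * ρ) * t ≤ (M ^ 2 * ρ) * ρ := by
      rw [mul_comm 8, mul_assoc]; gcongr; linarith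
    have e3 : 0 ≤ w * (M * ρ) := by positivity
    nlinarith
  have c3 : 1.4 * w ≤ √(2 * ρ * v) := by
    apply Real.le_sqrt_of_sq_le
    rw [mul_pow, hw2]
    nlinarith [mul_nonneg hρ0.le hV]
  have c4 : 9 * (M * t) ≤ M * ρ := by nlinarith
  have c5 : 0 ≤ M * t := by positivity
  linarith

/-- With probability at least `1 / 2` a sample yields an upper bound for the expectation. Only the
spread of the sample enters, so that this event can be compared with a first sample. -/
lemma half_le_pi_real (hn : 1000 ≤ n) (hM : 0 < M) (hf : Measurable f) (hf1 : ∀ z, |f z| ≤ M) :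
    1 / 2 ≤ (Measure.pi fun _ : Fin n => P).real {S | n * ∫ z, f z ∂P ≤
      ∑ i, f (S i) + √(17 * ssd fun i => f (S i)) + 25 * M} := by
  have hn0 : 0 < n := by omega
  have hnR : (1000 : ℝ) ≤ n := by exact_mod_cast hn
  have hV : 0 ≤ n * variance f P := mul_nonneg (Nat.cast_nonneg n) (variance_nonneg f P)
  -- three events, each of probability at most `exp (-2) < 1 / 6`
  have h1 := pi_real_bernstein (P := P) (n := n) hM hf hf1 two_pos
  have h2 := pi_real_bernstein_lower (P := P) (n := n) hM hf hf1 two_pos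
  have h3 := pi_real_sum_sq_le_le (P := P) (n := n) hM hf hf1 2
  set m := ∫ z, f z ∂P
  set v := n * variance f P
  set G := {S : Fin n → Z | n * m ≤ ∑ i, f (S i) + √(17 * ssd fun i => f (S i)) + 25 * M}
  have hexp : Real.exp (-2) ≤ 1 / 6 := by
    rw [Real.exp_neg, one_div]
    apply inv_anti₀ (by norm_num)
    have := Real.exp_one_gt_d9
    rw [show (2 : ℝ) = 1 + 1 by norm_num, Real.exp_add]
    nlinarith
  have hbad : (Measure.pi fun _ : Fin n => P).real Gᶜ ≤ 1 / 2 := by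
    refine le_trans (measureReal_mono (fun S hS => ?_) (measure_ne_top _ _)) <|
      (measureReal_union_le _ _).trans <|
      (add_le_add ((measureReal_union_le _ _).trans (add_le_add h1 h2)) h3).trans (by linarith)
    by_contra hcon
    simp only [Set.mem_union, Set.mem_ofPred_eq, not_or, not_le, G, Set.mem_compl_iff] at hcon hS
    obtain ⟨⟨g1, g2⟩, g3⟩ := hcon
    rw [sum_sub_sq_eq hn0 (fun i => f (S i))] at g3
    have hs0 := ssd_nonneg fun i => f (S i)
    have hmean := sum_eq_mul_mean hn0 (fun i => f (S i))
    set s := ssd fun i => f (S i)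
    set q := mean fun i => f (S i)
    set r := √(2 * v) with hr
    have hr0 : 0 ≤ r := Real.sqrt_nonneg _
    have hr2 : r ^ 2 = 2 * v := Real.sq_sqrt (by positivity)
    rw [hmean] at g1 g2 hS
    have d1 : (n * (q - m)) ^ 2 ≤ 16 * v + 32 * M ^ 2 := by
      have : (n * (q - m)) ^ 2 ≤ (2 * r + 4 * M) ^ 2 :=
        sq_le_sq' (by linarith) (by linarith)
      nlinarith [sq_nonneg (2 * r - 4 * M)]
    have d2 : n * (q - m) ^ 2 ≤ (16 * v + 32 * M ^ 2) / 1000 := by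
      rw [le_div_iff₀ (by norm_num)]
      refine le_trans ?_ d1
      rw [show (n * (q - m)) ^ 2 = (n * (q - m) ^ 2) * n by ring]
      gcongr
    have d3 : v ≤ 2.07 * s + 33.2 * M ^ 2 := by nlinarith [sq_nonneg M]
    have d4 : 2 * r ≤ √(17 * s) + 17 * M := by
      have e0 := Real.sqrt_nonneg (17 * s)
      have e2 : √(17 * s) ^ 2 = 17 * s := Real.sq_sqrt (by positivity)
      apply le_of_sq_le_sq _ (by positivity)
      nlinarith [mul_nonneg e0 hM.le, sq_nonneg M]
    linarith
  have huniv : (1 : ℝ) ≤ (Measure.pi fun _ : Fin n => P).real G +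
      (Measure.pi fun _ : Fin n => P).real Gᶜ := by
    have := measureReal_union_le (μ := Measure.pi fun _ : Fin n => P) G Gᶜ
    rwa [Set.union_compl_self, probReal_univ] at this
  linarith

/-- The joint law of two independent samples is invariant under exchanging their entries, so that
the probability of an event is at most the largest fraction of exchanges that produce it. -/
lemma prod_pi_real_le_of_exchange {A : Set ((Fin n → Z) × (Fin n → Z))} (hA : MeasurableSet A)
    {κ : ℝ} (h : ∀ (x x' : Fin n → Z) (B : Finset (Fin n → Bool)),
      (∀ σ ∈ B, ((fun i => if σ i then x' i else x i), fun i => if σ i then x i else x' i) ∈ A) →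
        (B.card : ℝ) ≤ κ * 2 ^ n) :
    ((Measure.pi fun _ : Fin n => P).prod (Measure.pi fun _ : Fin n => P)).real A ≤ κ := by
  classical
  let E := MeasurableEquiv.arrowProdEquivProdArrow Z Z (Fin n)
  have hE : MeasurePreserving E _ _ :=
    measurePreserving_arrowProdEquivProdArrow Z Z (Fin n) (fun _ => P) (fun _ => P)
  let ex : (Fin n → Bool) → (Fin n → Z × Z) → Fin n → Z × Z := fun σ q i =>
    (if σ i then Prod.swap else id) (q i)
  have hex : ∀ σ, MeasurePreserving (ex σ) (Measure.pi fun _ : Fin n => P.prod P)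
      (Measure.pi fun _ : Fin n => P.prod P) := by
    intro σ
    refine measurePreserving_pi (f := fun i => if σ i then Prod.swap else id) _ _ fun i => ?_
    split_ifs
    · exact Measure.measurePreserving_swap
    · exact MeasurePreserving.id _
  set ν := Measure.pi fun _ : Fin n => P.prod P
  let A' : (Fin n → Bool) → Set (Fin n → Z × Z) := fun σ => ex σ ⁻¹' (E ⁻¹' A)
  have hA' : ∀ σ, MeasurableSet (A' σ) := fun σ => (hex σ).measurable (E.measurable hA)
  have hμ : ∀ σ, ν.real (A' σ) =
      ((Measure.pi fun _ : Fin n => P).prod (Measure.pi fun _ : Fin n => P)).real A := by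
    intro σ
    rw [measureReal_def, measureReal_def,
      (hex σ).measure_preimage (E.measurable hA).nullMeasurableSet,
      hE.measure_preimage hA.nullMeasurableSet]
  have hint : ∀ σ, Integrable ((A' σ).indicator fun _ => (1 : ℝ)) ν := fun σ =>
    (integrable_const 1).indicator (hA' σ)
  have hsum : ∑ σ : Fin n → Bool, ν.real (A' σ) ≤ κ * 2 ^ n := by
    have e1 : ∀ σ, ν.real (A' σ) = ∫ q, (A' σ).indicator (fun _ => (1 : ℝ)) q ∂ν := by
      intro σ
      rw [integral_indicator_const _ (hA' σ)]; simp
    simp only [e1]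
    rw [← integral_finsetSum _ fun σ _ => hint σ]
    have e2 : ∫ _q, κ * 2 ^ n ∂ν = κ * 2 ^ n := by simp
    rw [← e2]
    refine integral_mono (integrable_finsetSum _ fun σ _ => hint σ) (integrable_const _)
      fun q => ?_
    have e3 := h (fun i => (q i).1) (fun i => (q i).2) (Finset.univ.filter fun σ => q ∈ A' σ) (by
      intro σ hσ
      have := (Finset.mem_filter.1 hσ).2
      convert (show E (ex σ q) ∈ A from this) using 1
      ext i
      · simp only [E, ex, MeasurableEquiv.arrowProdEquivProdArrow, Equiv.arrowProdEquivProdArrow]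
        by_cases hi : σ i <;> simp [hi]
      · simp only [E, ex, MeasurableEquiv.arrowProdEquivProdArrow, Equiv.arrowProdEquivProdArrow]
        by_cases hi : σ i <;> simp [hi])
    refine le_trans (le_of_eq ?_) e3
    simp [Set.indicator_apply, Finset.sum_boole]
  simp only [hμ] at hsum
  simp only [Finset.sum_const, Finset.card_univ, Fintype.card_pi, Fintype.card_bool,
    Finset.prod_const, Fintype.card_fin, nsmul_eq_mul] at hsum
  push_cast at hsum
  have h2 : (0 : ℝ) < 2 ^ n := by positivity
  rw [mul_comm] at hsum
  exact le_of_mul_le_mul_right hsum h2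

/-- Symmetrization by a second sample. No measurability of `B` is needed. -/
lemma real_le_two_mul_prod_real {Ω : Type*} [MeasurableSpace Ω] {μ : Measure Ω}
    [IsProbabilityMeasure μ] {A : Set (Ω × Ω)} (hA : MeasurableSet A) {B : Set Ω}
    (hB : ∀ ω ∈ B, 1 / 2 ≤ μ.real (Prod.mk ω ⁻¹' A)) :
    μ.real B ≤ 2 * (μ.prod μ).real A := by
  have hm : Measurable fun ω => μ (Prod.mk ω ⁻¹' A) := measurable_measure_prodMk_left hA
  have hreal : (μ.prod μ).real A = ∫ ω, μ.real (Prod.mk ω ⁻¹' A) ∂μ := by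
    rw [measureReal_def, Measure.prod_apply hA, integral_eq_lintegral_of_nonneg_ae
      (.of_forall fun _ => measureReal_nonneg) hm.ennreal_toReal.aestronglyMeasurable]
    congr 1
    refine lintegral_congr fun ω => ?_
    rw [measureReal_def, ENNReal.ofReal_toReal (measure_ne_top _ _)]
  have hint : Integrable (fun ω => μ.real (Prod.mk ω ⁻¹' A)) μ :=
    Integrable.of_bound hm.ennreal_toReal.aestronglyMeasurable 1 (.of_forall fun ω => by
      rw [Real.norm_eq_abs, abs_of_nonneg measureReal_nonneg]
      exact measureReal_le_one)
  have h1 := mul_meas_ge_le_integral_of_nonneg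
    (.of_forall fun ω => measureReal_nonneg (μ := μ) (s := Prod.mk ω ⁻¹' A)) hint (1 / 2)
  have h2 : μ.real B ≤ μ.real {ω | 1 / 2 ≤ μ.real (Prod.mk ω ⁻¹' A)} :=
    measureReal_mono hB (measure_ne_top _ _)
  rw [hreal]
  linarith

end samples

/-! ### Deviation bounds for the minimizer -/

section learner
variable {W : Type*} {Z : Type*} [MeasurableSpace W] [MeasurableSpace Z] {P : Measure Z}
  [IsProbabilityMeasure P] {ℓ : W → Z → ℝ} {Θ : Set W} {θref : W} {M : ℝ} {d n : ℕ}

lemma measurable_rhoLoss (hℓ : Measurable (Function.uncurry ℓ)) (θ : W) :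
    Measurable (rhoLoss ℓ θref θ) :=
  (hℓ.comp measurable_prodMk_left).sub (hℓ.comp measurable_prodMk_left)

/-- The uniform upper bound, at a measurable choice of the parameter: the expected shifted loss is
at most its empirical mean plus the standard deviation term. Symmetrization is applied to the
selected parameter, and only the resulting finite average over exchanges is bounded uniformly over
`Θ`, so that no measurability of suprema over `Θ` enters. -/
lemma pi_real_expected_gt_le (hℓ : Measurable (Function.uncurry ℓ))
    (hd : vcDim (rhoLoss ℓ θref '' Θ) ≤ d) (hM : 0 < M)
    (hb : ∀ θ ∈ Θ, ∀ z, |rhoLoss ℓ θref θ z| ≤ M) {t ρ : ℝ} (ht : 100 ≤ t) (hnt : 75 * t ≤ n)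
    (hρ : 9 * t ≤ ρ) {θtilde : (Fin n → Z) → W} (hθ : Measurable θtilde)
    (hΘ : ∀ᵐ S ∂(Measure.pi fun _ : Fin n => P), θtilde S ∈ Θ) :
    (Measure.pi fun _ : Fin n => P).real {S |
      ∑ i, rhoLoss ℓ θref (θtilde S) (S i) +
        √(2 * ρ * ssd fun i => rhoLoss ℓ θref (θtilde S) (S i)) + 5 * M * ρ <
      n * ∫ z, rhoLoss ℓ θref (θtilde S) z ∂P} ≤
    2 * ((4 * (n : ℝ) ^ 2 + 1) ^ d * (4 * Real.exp (-t))) := by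
  have hnR : (1000 : ℝ) ≤ n := by linarith
  have hn : 1000 ≤ n := by exact_mod_cast hnR
  -- a measurable set of full measure on which the choice lies in `Θ`
  obtain ⟨G, hG, hGm, hGsub⟩ := hΘ.exists_measurable_mem
  let x : (Fin n → Z) × (Fin n → Z) → Fin n → ℝ := fun p i => rhoLoss ℓ θref (θtilde p.1) (p.1 i)
  let x' : (Fin n → Z) × (Fin n → Z) → Fin n → ℝ := fun p i => rhoLoss ℓ θref (θtilde p.1) (p.2 i)
  let A : Set ((Fin n → Z) × (Fin n → Z)) := {p | p.1 ∈ G ∧ √(2 * ρ * ssd (x p)) + 5 * M * ρ <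
    ∑ i, x' p i - ∑ i, x p i + √(17 * ssd (x' p)) + 25 * M}
  have hxm : ∀ i, Measurable fun p => x p i := fun i =>
    (hℓ.comp ((hθ.comp measurable_fst).prodMk ((measurable_pi_apply i).comp measurable_fst))).sub
      (hℓ.comp (measurable_const.prodMk ((measurable_pi_apply i).comp measurable_fst)))
  have hxm' : ∀ i, Measurable fun p => x' p i := fun i =>
    (hℓ.comp ((hθ.comp measurable_fst).prodMk ((measurable_pi_apply i).comp measurable_snd))).sub
      (hℓ.comp (measurable_const.prodMk ((measurable_pi_apply i).comp measurable_snd)))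
  have hssd : ∀ {y : (Fin n → Z) × (Fin n → Z) → Fin n → ℝ}, (∀ i, Measurable fun p => y p i) →
      Measurable fun p => ssd (y p) := by
    intro y hy
    unfold ssd mean
    fun_prop
  have hA : MeasurableSet A := by
    have hlt : MeasurableSet {p | √(2 * ρ * ssd (x p)) + 5 * M * ρ <
        ∑ i, x' p i - ∑ i, x p i + √(17 * ssd (x' p)) + 25 * M} := measurableSet_lt ?_ ?_
    · exact (measurable_fst hGm).inter hlt
    · exact ((hssd hxm).const_mul _).sqrt.add_const _
    · exact (((Finset.measurable_sum _ fun i _ => hxm' i).sub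
        (Finset.measurable_sum _ fun i _ => hxm i)).add ((hssd hxm').const_mul _).sqrt).add_const _
  have hκ := prod_pi_real_le_of_exchange (P := P) hA (κ := (4 * (n : ℝ) ^ 2 + 1) ^ d *
      (4 * Real.exp (-t))) (by
    intro z z' B hB
    refine card_exchanges_le (F := rhoLoss ℓ θref '' Θ) hd hM ?_ (by omega) ht hnt hρ z z' B ?_
    · rintro _ ⟨θ, hθ, rfl⟩
      exact hb θ hθ
    · intro σ hσ
      exact ⟨_, ⟨_, hGsub _ (hB σ hσ).1, rfl⟩, (hB σ hσ).2⟩)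
  refine le_trans ?_ (mul_le_mul_of_nonneg_left hκ two_pos.le)
  set B := {S : Fin n → Z | ∑ i, rhoLoss ℓ θref (θtilde S) (S i) +
        √(2 * ρ * ssd fun i => rhoLoss ℓ θref (θtilde S) (S i)) + 5 * M * ρ <
      n * ∫ z, rhoLoss ℓ θref (θtilde S) z ∂P} with hBdef
  have hBG : (Measure.pi fun _ : Fin n => P).real B =
      (Measure.pi fun _ : Fin n => P).real (B ∩ G) := by
    refine measureReal_congr ?_
    filter_upwards [hG] with S hS
    exact propext ⟨fun h => ⟨h, hS⟩, fun h => h.1⟩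
  rw [hBG]
  refine real_le_two_mul_prod_real hA fun S hS => ?_
  refine (half_le_pi_real (P := P) hn hM (measurable_rhoLoss (θref := θref) hℓ (θtilde S))
    (hb _ (hGsub _ hS.2))).trans (measureReal_mono (fun S' hS' => ?_) (measure_ne_top _ _))
  have h1 : (_ : ℝ) < _ := hS.1
  have h2 : (_ : ℝ) ≤ _ := hS'
  refine ⟨hS.2, ?_⟩
  simp only [x, x']
  linarith

/-- The two deviation bounds combined: the excess over the bound at a fixed parameter `θ₁` is
`11 M ρ / n` at most. -/
lemma pi_real_expected_gt_fixed_le (hℓ : Measurable (Function.uncurry ℓ))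
    (hd : vcDim (rhoLoss ℓ θref '' Θ) ≤ d) (hM : 0 < M)
    (hb : ∀ θ ∈ Θ, ∀ z, |rhoLoss ℓ θref θ z| ≤ M) {t ρ : ℝ} (ht : 100 ≤ t) (hnt : 75 * t ≤ n)
    (hρ : 9 * t ≤ ρ) {θtilde : (Fin n → Z) → W} (hθ : Measurable θtilde)
    (hΘ : ∀ᵐ S ∂(Measure.pi fun _ : Fin n => P), θtilde S ∈ Θ ∧
      IsMinOn (drrhoRisk chiSqPhi ℓ θref ρ S) Θ (θtilde S)) {θ₁ : W} (hθ₁ : θ₁ ∈ Θ) :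
    (Measure.pi fun _ : Fin n => P).real {S |
      n * ∫ z, rhoLoss ℓ θref θ₁ z ∂P + 2 * √(2 * ρ * (n * variance (rhoLoss ℓ θref θ₁) P)) +
        11 * M * ρ < n * ∫ z, rhoLoss ℓ θref (θtilde S) z ∂P} ≤
    2 * ((4 * (n : ℝ) ^ 2 + 1) ^ d * (4 * Real.exp (-t))) + 2 * Real.exp (-t) := by
  have hn0 : 0 < n := by
    have : (0 : ℝ) < n := by linarith
    exact_mod_cast this
  have hn' : (0 : ℝ) < n := by exact_mod_cast hn0
  have hρ0 : 0 ≤ ρ := by linarith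
  have hB := pi_real_expected_gt_le (P := P) hℓ hd hM hb ht hnt hρ hθ (hΘ.mono fun _ h => h.1)
  have hA := pi_real_empirical_gt_le (P := P) hn0 hM (measurable_rhoLoss (θref := θref) hℓ θ₁)
    (hb θ₁ hθ₁) (by linarith) hρ
  refine le_trans ?_ ((measureReal_union_le _ _).trans (add_le_add hB hA))
  refine ENNReal.toReal_mono (measure_ne_top _ _) (measure_mono_ae ?_)
  filter_upwards [hΘ] with S hS hlt
  by_contra hcon
  change ¬ (_ ∨ _) at hcon
  rw [not_or] at hcon
  obtain ⟨g1, g2⟩ := hcon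
  change ¬ ((_ : ℝ) < _) at g1 g2
  change (_ : ℝ) < _ at hlt
  rw [not_lt] at g1 g2
  have k1 := mean_add_le_drrhoRisk (ρ := ρ) (S := S) hn0 hρ0 hM.le
    (fun i => hb _ hS.1 (S i))
  have k2 : drrhoRisk chiSqPhi ℓ θref ρ S (θtilde S) ≤ drrhoRisk chiSqPhi ℓ θref ρ S θ₁ :=
    hS.2 hθ₁
  have k3 := drrhoRisk_le (ℓ := ℓ) (θref := θref) (θ := θ₁) (S := S) hn0 hρ0
  have k4 := k1.trans ((add_le_add_left (k2.trans k3) _))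
  rw [sum_eq_mul_mean hn0] at g1 g2
  have k5 := mul_le_mul_of_nonneg_left k4 hn'.le
  simp only [mul_add, mul_div_cancel₀ _ hn'.ne'] at k5
  linarith

end learner

/-! ### The generalization bound -/

section final
variable {W : Type*} {Z : Type*} [MeasurableSpace W] [MeasurableSpace Z] {P : Measure Z}
  [IsProbabilityMeasure P] {ℓ : W → Z → ℝ} {θref θ : W}

lemma one_sub_le_real_of_compl {Ω : Type*} [MeasurableSpace Ω] {μ : Measure Ω}
    [IsProbabilityMeasure μ] {p : Ω → Prop} {δ : ℝ} (h : μ.real {ω | ¬ p ω} ≤ δ) :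
    1 - δ ≤ μ.real {ω | p ω} := by
  have h1 := measureReal_union_le (μ := μ) {ω | p ω} {ω | ¬ p ω}
  have h2 : {ω | p ω} ∪ {ω | ¬ p ω} = Set.univ := Set.eq_univ_of_forall fun ω => em (p ω)
  rw [h2, probReal_univ] at h1
  linarith

lemma integral_rhoLoss {M₀ M₁ : ℝ} (hℓ : Measurable (Function.uncurry ℓ))
    (hθ : ∀ z, ℓ θ z ∈ Set.Icc M₀ M₁) (href : ∀ z, ℓ θref z ∈ Set.Icc M₀ M₁) :
    ∫ z, rhoLoss ℓ θref θ z ∂P = risk ℓ P θ - risk ℓ P θref := by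
  have h : ∀ η : W, (∀ z, ℓ η z ∈ Set.Icc M₀ M₁) → Integrable (ℓ η) P := fun η hη =>
    Integrable.of_mem_Icc M₀ M₁ (hℓ.comp measurable_prodMk_left).aemeasurable (.of_forall hη)
  exact integral_sub (h θ hθ) (h θref href)

lemma risk_mem_Icc {M₀ M₁ : ℝ} (hℓ : Measurable (Function.uncurry ℓ))
    (hθ : ∀ z, ℓ θ z ∈ Set.Icc M₀ M₁) : risk ℓ P θ ∈ Set.Icc M₀ M₁ := by
  have h : Integrable (ℓ θ) P :=
    Integrable.of_mem_Icc M₀ M₁ (hℓ.comp measurable_prodMk_left).aemeasurable (.of_forall hθ)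
  constructor
  · have := integral_mono (integrable_const M₀) h fun z => (hθ z).1
    simpa [risk] using this
  · have := integral_mono h (integrable_const M₁) fun z => (hθ z).2
    simpa [risk] using this

/-- The choice of `C₁`: the union bound over the rounded class costs at most `δ`. -/
lemma union_bound_le {δ : ℝ} (hδ : 0 < δ) {n : ℕ} (hn : 0 < n) (d : ℕ) :
    2 * ((4 * (n : ℝ) ^ 2 + 1) ^ d * (4 * Real.exp (-constC1 (Real.exp 100) δ d n))) +
      2 * Real.exp (-constC1 (Real.exp 100) δ d n) ≤ δ := by
  have hn1 : (1 : ℝ) ≤ n := by exact_mod_cast hn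
  have hn' : (0 : ℝ) < n := by linarith
  have hn2 : (1 : ℝ) ≤ (n : ℝ) ^ 2 := one_le_pow₀ hn1
  set K : ℝ := (16 * Real.exp 1 * (n : ℝ) ^ 2) ^ d with hK
  have hK0 : 0 < K := by positivity
  have he : Real.exp (constC1 (Real.exp 100) δ d n) = Real.exp 100 / δ * K := by
    rw [constC1, Real.exp_add, Real.exp_add, Real.exp_add, Real.exp_log (by positivity),
      Real.log_exp, Real.exp_nat_mul, Real.exp_log (by positivity),
      show 2 * (d : ℝ) * Real.log n = (d : ℝ) * (2 * Real.log n) by ring, Real.exp_nat_mul,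
      show 2 * Real.log n = ((2 : ℕ) : ℝ) * Real.log n by norm_num, Real.exp_nat_mul,
      Real.exp_log hn', hK, mul_pow]
    ring
  have he1 : (1 : ℝ) ≤ Real.exp 1 := Real.one_le_exp zero_le_one
  have hK1 : 1 ≤ K := one_le_pow₀ (by nlinarith)
  have hK2 : (4 * (n : ℝ) ^ 2 + 1) ^ d ≤ K := pow_le_pow_left₀ (by positivity) (by nlinarith) d
  have h100 : 10 ≤ Real.exp 100 := by linarith [Real.add_one_le_exp (100 : ℝ)]
  rw [Real.exp_neg, he]
  set E := (Real.exp 100 / δ * K)⁻¹ with hE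
  have hE0 : 0 < E := by positivity
  have hEK : K * E = δ / Real.exp 100 := by rw [hE]; field_simp
  have h1 : (4 * (n : ℝ) ^ 2 + 1) ^ d * E ≤ K * E := by gcongr
  have h2 : 1 * E ≤ K * E := by gcongr
  have h3 : 10 * (δ / Real.exp 100) ≤ δ := by
    rw [← mul_div_assoc, div_le_iff₀ (Real.exp_pos _)]
    nlinarith
  linarith

lemma le_constC1 {δ : ℝ} (hδ : 0 < δ) (hδ1 : δ ≤ 1) {n : ℕ} (hn : 0 < n) (d : ℕ) :
    100 ≤ constC1 (Real.exp 100) δ d n := by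
  have hn1 : (1 : ℝ) ≤ n := by exact_mod_cast hn
  have h1 : 0 ≤ Real.log (1 / δ) := Real.log_nonneg (by rw [le_div_iff₀ hδ]; linarith)
  have h2 : 0 ≤ d * Real.log (16 * Real.exp 1) :=
    mul_nonneg (Nat.cast_nonneg d)
      (Real.log_nonneg (by linarith [Real.one_le_exp (zero_le_one (α := ℝ))]))
  have h3 : 0 ≤ 2 * (d : ℝ) * Real.log n := mul_nonneg (by positivity) (Real.log_nonneg hn1)
  rw [constC1, Real.log_exp]
  linarith

end final
end DRRho

theorem mainTheorem1 :
    ∃ c : ℝ, 0 < c ∧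
      ∀ (W : Type u) (Z : Type v) [MeasurableSpace W] [MeasurableSpace Z]
        (P : Measure Z) [IsProbabilityMeasure P]
        (ℓ : W → Z → ℝ) (_ : Measurable (Function.uncurry ℓ))
        (Θ : Set W) (θref : W) (M₀ M₁ : ℝ)
        (_ : ∀ θ ∈ Θ, ∀ z, ℓ θ z ∈ Set.Icc M₀ M₁)
        (_ : ∀ z, ℓ θref z ∈ Set.Icc M₀ M₁)
        (d : ℕ) (_ : DRRho.vcDim (DRRho.rhoLoss ℓ θref '' Θ) = (d : ℕ∞))
        (n : ℕ) (_ : 0 < n) (δ : ℝ) (_ : 0 < δ) (ρ : ℝ)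
        (_ : 32 * (M₁ - M₀) ^ 2 ≤ DRRho.constC1 c δ d n * n)
        (_ : 9 * DRRho.constC1 c δ d n ≤ ρ)
        (θtilde : (Fin n → Z) → W) (_ : Measurable θtilde)
        (_ : ∀ᵐ S ∂(Measure.pi fun _ : Fin n => P), θtilde S ∈ Θ ∧
          IsMinOn (DRRho.drrhoRisk DRRho.chiSqPhi ℓ θref ρ S) Θ (θtilde S)),
        1 - δ ≤ (Measure.pi fun _ : Fin n => P).real
          {S | DRRho.risk ℓ P (θtilde S) ≤
            (⨅ θ : Θ, (DRRho.risk ℓ P θ +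
              2 * Real.sqrt (2 * ρ / n * variance (DRRho.rhoLoss ℓ θref θ) P))) +
            (50 * ρ / 3 + 4) * (M₁ - M₀) / n} := by
  refine ⟨Real.exp 100, Real.exp_pos _, ?_⟩
  intro W Z _ _ P _ ℓ hℓ Θ θref M₀ M₁ hΘ href d hd n hn δ hδ ρ _ hρ θtilde hθ hmin
  have hn' : (0 : ℝ) < n := by exact_mod_cast hn
  rcases le_or_gt 1 δ with hδ1 | hδ1
  · exact le_trans (by linarith) measureReal_nonneg
  have ht := DRRho.le_constC1 hδ hδ1.le hn d
  have hun := DRRho.union_bound_le hδ hn d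
  set t := DRRho.constC1 (Real.exp 100) δ d n
  obtain ⟨S₀, hS₀⟩ := hmin.exists
  have hne : Nonempty Θ := ⟨⟨_, hS₀.1⟩⟩
  apply DRRho.one_sub_le_real_of_compl
  have hM0 : M₀ ≤ M₁ := by
    obtain ⟨z⟩ := nonempty_of_isProbabilityMeasure P
    exact (href z).1.trans (href z).2
  -- the risks of two parameters differ by at most `M₁ - M₀`
  rcases le_or_gt (M₁ - M₀) ((50 * ρ / 3 + 4) * (M₁ - M₀) / n) with htriv | hlarge
  · refine le_trans (le_of_eq ?_) hδ.le
    rw [measureReal_eq_zero_iff, ← ae_iff]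
    filter_upwards [hmin] with S hS
    have h1 : M₀ ≤ ⨅ θ : Θ, (DRRho.risk ℓ P θ +
        2 * Real.sqrt (2 * ρ / n * variance (DRRho.rhoLoss ℓ θref θ) P)) :=
      le_ciInf fun θ => by
        have := (DRRho.risk_mem_Icc (P := P) hℓ (hΘ θ θ.2)).1
        have := Real.sqrt_nonneg (2 * ρ / n * variance (DRRho.rhoLoss ℓ θref θ) P)
        linarith
    have h2 := (DRRho.risk_mem_Icc (P := P) hℓ (hΘ _ hS.1)).2
    linarith
  have hM : 0 < M₁ - M₀ := by
    rcases (sub_nonneg.2 hM0).eq_or_lt with h | h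
    · simp [← h] at hlarge
    · exact h
  have hnρ : 50 * ρ / 3 + 4 < n := by
    rw [div_lt_iff₀ hn', mul_comm (M₁ - M₀)] at hlarge
    exact lt_of_mul_lt_mul_right hlarge hM.le
  have hb : ∀ θ ∈ Θ, ∀ z, |DRRho.rhoLoss ℓ θref θ z| ≤ M₁ - M₀ := by
    intro θ hθΘ z
    have h1 := hΘ θ hθΘ z
    have h2 := href z
    rw [DRRho.rhoLoss, abs_le]
    constructor <;> linarith [h1.1, h1.2, h2.1, h2.2]
  -- a near-minimiser of the right-hand side
  obtain ⟨θ₁, hθ₁⟩ := exists_lt_of_ciInf_lt (lt_add_of_pos_right (⨅ θ : Θ, (DRRho.risk ℓ P θ +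
    2 * Real.sqrt (2 * ρ / n * variance (DRRho.rhoLoss ℓ θref θ) P))) (div_pos hM hn'))
  have hkey := DRRho.pi_real_expected_gt_fixed_le (P := P) hℓ hd.le hM hb ht (by linarith) hρ hθ
    hmin θ₁.2
  refine le_trans ?_ (hkey.trans hun)
  refine ENNReal.toReal_mono (measure_ne_top _ _) (measure_mono_ae ?_)
  filter_upwards [hmin] with S hS hlt
  change ¬ ((_ : ℝ) ≤ _) at hlt
  rw [not_le] at hlt
  change (_ : ℝ) < _
  rw [DRRho.integral_rhoLoss hℓ (hΘ _ hS.1) href, DRRho.integral_rhoLoss hℓ (hΘ _ θ₁.2) href]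
  set V := variance (DRRho.rhoLoss ℓ θref θ₁) P
  have hsq : (n : ℝ) * √(2 * ρ / n * V) = √(2 * ρ * (n * V)) := by
    rw [show 2 * ρ * (n * V) = (n : ℝ) ^ 2 * (2 * ρ / n * V) by field_simp,
      Real.sqrt_mul (sq_nonneg (n : ℝ)), Real.sqrt_sq hn'.le]
  have h1 : DRRho.risk ℓ P θ₁ + 2 * √(2 * ρ / n * V) + (50 * ρ / 3 + 3) * (M₁ - M₀) / n <
      DRRho.risk ℓ P (θtilde S) := by
    have : (50 * ρ / 3 + 4) * (M₁ - M₀) / n =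
        (50 * ρ / 3 + 3) * (M₁ - M₀) / n + (M₁ - M₀) / n := by ring
    linarith
  have h2 := mul_lt_mul_of_pos_left h1 hn'
  rw [mul_add, mul_add, mul_div_cancel₀ _ hn'.ne', mul_left_comm, hsq] at h2
  have h3 : 0 ≤ (M₁ - M₀) * ρ := mul_nonneg hM.le (by linarith)
  linarith
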